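/- Let $\Gamma$ be a group, of arbitrary cardinality. A (left) ordering on $\Gamma$ is a total order relation $\preceq$ on $\Gamma$ that is invariant under left multiplication, that is, $a \preceq b$ implies $ca \preceq cb$ for all $a,b,c \in \Gamma$; $\Gamma$ is called orderable if it admits such an ordering. Let $\mathcal{LO}(\Gamma)$ be the space of all orderings on $\Gamma$, with the topology generated by the sets $\{\preceq\ : f \succ 1\}$ for $f \in \Gamma$, $f \neq 1$. If $\Gamma$ is orderable and $\mathcal{LO}(\Gamma)$ is infinite, then $\mathcal{LO}(\Gamma)$ is uncountable. -/

import Mathlib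

/-- A (left) ordering on a group `Γ`: a total order relation on `Γ` that is invariant under
left multiplication. -/
@[ext]
structure LeftOrdering (Γ : Type*) [Group Γ] where
  /-- The order relation. -/
  le : Γ → Γ → Prop
  le_refl : ∀ a, le a a
  le_trans : ∀ a b c, le a b → le b c → le a c
  le_antisymm : ∀ a b, le a b → le b a → a = b
  le_total : ∀ a b, le a b ∨ le b a
  mul_left : ∀ c a b, le a b → le (c * a) (c * b)

namespace LeftOrdering

/-- The strict order relation of a left ordering. -/
def lt {Γ : Type*} [Group Γ] (o : LeftOrdering Γ) (a b : Γ) : Prop :=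
  o.le a b ∧ a ≠ b

/-- The type `LeftOrdering Γ` is the space of left orderings of `Γ`: its topology has as a subbasis
the sets of all orderings for which `f` is positive, where `f ≠ 1`. -/
instance {Γ : Type*} [Group Γ] : TopologicalSpace (LeftOrdering Γ) :=
  TopologicalSpace.generateFrom {U | ∃ f : Γ, f ≠ 1 ∧ U = {o : LeftOrdering Γ | o.lt 1 f}}

end LeftOrdering

/-! Orderings correspond to positive cones, so it suffices that a group with countably many cones
has finitely many (`finite_setOf_isCone`). The cones form a compact space on which the group acts by
conjugation. If it is countable and nonempty, Baire and minimality give a finite orbit, hence a cone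
`P` normalized by some power of every element. Reversing `P` on any set of convex jumps gives
another cone, so the convex subgroups form a finite chain ⊥ = C 0 < ... < C n = ⊤. The powers
normalizing `P` make each jump Archimedean, and Hölder's theorem gives φ i : C (i+1) → ℝ, a
homomorphism with kernel C i.

An increasing action of a convex subgroup on ℝ, with a base point, defines a cone, so
real-parametrized families of distinguishable actions are excluded (`false_of_separated_actions`).
With translations this shows that homomorphisms from a convex subgroup to ℝ are proportional and of
rank one. So conjugation multiplies φ i by scalars, and every C i is normal. Some element of C (i+2)
must scale φ i negatively: if all scalars are positive but not all 1, affine actions give too many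
cones, and if all are 1, φ i extends to a homomorphism not proportional to φ (i+1).

Such a reversing element g is rigid: in any cone, whichever of g, g⁻¹ is positive exceeds all of C
(i+1), so by rank one the sign of g fixes the signs on the next jump. By induction every cone agrees
with `P` up to a sign on each jump, which leaves at most 2^n cones. -/

/-- The positive cones of left orderings of a group. -/
structure IsCone {G : Type*} [Group G] (P : Set G) : Prop where
  one_notMem : (1 : G) ∉ P
  mul_mem : ∀ {x y}, x ∈ P → y ∈ P → x * y ∈ P
  total : ∀ {x}, x ≠ 1 → x ∈ P ∨ x⁻¹ ∈ P

namespace IsCone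

variable {G : Type*} [Group G] {P : Set G}

theorem inv_notMem (hP : IsCone P) {x : G} (hx : x ∈ P) : x⁻¹ ∉ P := fun h =>
  hP.one_notMem (by simpa using hP.mul_mem hx h)

theorem ne_one (hP : IsCone P) {x : G} (hx : x ∈ P) : x ≠ 1 := by
  rintro rfl
  exact hP.one_notMem hx

theorem inv_mem_iff (hP : IsCone P) {x : G} (hx : x ≠ 1) : x⁻¹ ∈ P ↔ x ∉ P :=
  ⟨fun h h' => hP.inv_notMem h' h, fun h => (hP.total hx).resolve_left h⟩

theorem pow_mem (hP : IsCone P) {x : G} (hx : x ∈ P) {n : ℕ} (hn : 0 < n) : x ^ n ∈ P := by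
  induction n, hn using Nat.le_induction with
  | base => simpa using hx
  | succ n _ ih => rw [pow_succ]; exact hP.mul_mem ih hx

theorem pow_mem_iff (hP : IsCone P) {x : G} {n : ℕ} (hn : 0 < n) : x ^ n ∈ P ↔ x ∈ P := by
  refine ⟨fun h => ?_, fun h => hP.pow_mem h hn⟩
  by_contra hx
  have h1 : x ≠ 1 := by
    rintro rfl
    exact hP.one_notMem (by simpa using h)
  have := hP.pow_mem ((hP.inv_mem_iff h1).2 hx) hn
  rw [inv_pow] at this
  exact hP.inv_notMem h this

/-- Two cones, one contained in the other, are equal. -/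
theorem eq_of_subset (hP : IsCone P) {Q : Set G} (hQ : IsCone Q) (h : P ⊆ Q) : P = Q := by
  refine h.antisymm fun x hx => ?_
  by_contra hxP
  exact hQ.inv_notMem hx (h ((hP.inv_mem_iff (hQ.ne_one hx)).2 hxP))

end IsCone

/-- Left orderings correspond to positive cones. -/
def leftOrderingEquiv (G : Type*) [Group G] : LeftOrdering G ≃ {P : Set G // IsCone P} where
  toFun o := ⟨{x | o.lt 1 x}, by
    refine ⟨fun h => h.2 rfl, fun {x y} hx hy => ?_, fun {x} hx => ?_⟩
    · have hxy : o.le x (x * y) := by simpa using o.mul_left x _ _ hy.1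
      refine ⟨o.le_trans _ _ _ hx.1 hxy, fun h => hx.2 ?_⟩
      rw [← h] at hxy
      exact o.le_antisymm _ _ hx.1 hxy
    · rcases o.le_total 1 x with h | h
      · exact Or.inl ⟨h, hx.symm⟩
      · refine Or.inr ⟨?_, fun h' => hx (by simpa using h'.symm)⟩
        simpa using o.mul_left x⁻¹ _ _ h⟩
  invFun P :=
    { le := fun a b => a = b ∨ a⁻¹ * b ∈ P.1
      le_refl := fun a => Or.inl rfl
      le_trans := by
        rintro a b c (rfl | h) (rfl | h')
        · exact Or.inl rfl
        · exact Or.inr h'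
        · exact Or.inr h
        · right
          simpa [mul_assoc] using P.2.mul_mem h h'
      le_antisymm := by
        rintro a b (h | h) (h' | h')
        · exact h
        · exact h
        · exact h'.symm
        · exact absurd (by simpa using h') (P.2.inv_notMem h)
      le_total := fun a b => by
        by_cases hab : a = b
        · exact Or.inl (Or.inl hab)
        · have h : a⁻¹ * b ≠ 1 := fun h => hab (inv_mul_eq_one.1 h)
          rcases P.2.total h with h | h
          · exact Or.inl (Or.inr h)
          · exact Or.inr (Or.inr (by simpa using h))
      mul_left := by
        rintro c a b (rfl | h)
        · exact Or.inl rfl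
        · right
          simpa [mul_assoc] using h }
  left_inv o := by
    ext a b
    constructor
    · rintro (rfl | h)
      · exact o.le_refl _
      · simpa using o.mul_left a _ _ h.1
    · intro h
      by_cases hab : a = b
      · exact Or.inl hab
      · refine Or.inr ⟨by simpa using o.mul_left a⁻¹ _ _ h, fun h' => hab ?_⟩
        exact inv_mul_eq_one.1 h'.symm
  right_inv P := by
    ext x
    constructor
    · rintro ⟨h | h, h'⟩
      · exact absurd h h'
      · simpa using h
    · intro h
      exact ⟨Or.inr (by simpa using h), (P.2.ne_one h).symm⟩

/-! ### Convex subgroups -/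

/-- A subgroup is convex for the left ordering with positive cone `P`. -/
def IsConvex {G : Type*} [Group G] (P : Set G) (C : Subgroup G) : Prop :=
  ∀ ⦃x⦄, x ∈ P → ∀ ⦃y⦄, y ∈ P → x * y ∈ C → x ∈ C

namespace IsConvex

variable {G : Type*} [Group G] {P : Set G} {C D : Subgroup G}

/-- If c * x were negative, c⁻¹ = x * (x⁻¹ * c⁻¹) would be a product of positive elements lying in
C, forcing x ∈ C. With the right-hand version, the sign outside C is constant on double cosets of C.
-/
theorem mul_mem_left (hC : IsConvex P C) (hP : IsCone P) {c x : G} (hc : c ∈ C) (hx : x ∈ P)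
    (hxC : x ∉ C) : c * x ∈ P := by
  by_contra h
  have h1 : c * x ≠ 1 := fun h1 => hxC (by
    rw [← inv_eq_of_mul_eq_one_right h1]; exact C.inv_mem hc)
  have h2 := (hP.inv_mem_iff h1).2 h
  rw [mul_inv_rev] at h2
  exact hxC (hC hx h2 (by simpa using hc))

theorem mul_mem_right (hC : IsConvex P C) (hP : IsCone P) {c x : G} (hc : c ∈ C) (hx : x ∈ P)
    (hxC : x ∉ C) : x * c ∈ P := by
  by_contra h
  have h1 : x * c ≠ 1 := fun h1 => hxC (by
    rw [eq_inv_of_mul_eq_one_left h1]; exact C.inv_mem hc)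
  have h2 := (hP.inv_mem_iff h1).2 h
  rw [mul_inv_rev] at h2
  have h3 := hC h2 hx (by simpa using hc)
  exact hxC (by simpa using (C.mul_mem_cancel_left (C.inv_mem hc)).1 h3)

theorem mul_mem_left_iff (hC : IsConvex P C) (hP : IsCone P) {c x : G} (hc : c ∈ C)
    (hxC : x ∉ C) : c * x ∈ P ↔ x ∈ P := by
  refine ⟨fun h => ?_, fun h => hC.mul_mem_left hP hc h hxC⟩
  simpa using hC.mul_mem_left hP (C.inv_mem hc) h (fun h' => hxC ((C.mul_mem_cancel_left hc).1 h'))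

theorem mul_mem_right_iff (hC : IsConvex P C) (hP : IsCone P) {c x : G} (hc : c ∈ C)
    (hxC : x ∉ C) : x * c ∈ P ↔ x ∈ P := by
  refine ⟨fun h => ?_, fun h => hC.mul_mem_right hP hc h hxC⟩
  simpa using hC.mul_mem_right hP (C.inv_mem hc) h (fun h' => hxC ((C.mul_mem_cancel_right hc).1 h'))

/-- Positive x ∈ C \ D and y ∈ D \ C would make both x⁻¹ * y and its inverse positive. -/
theorem le_total (hC : IsConvex P C) (hD : IsConvex P D) (hP : IsCone P) : C ≤ D ∨ D ≤ C := by
  by_contra! h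
  obtain ⟨⟨x, hxC, hxD⟩, ⟨y, hyD, hyC⟩⟩ :=
    And.intro (SetLike.not_le_iff_exists.1 h.1) (SetLike.not_le_iff_exists.1 h.2)
  wlog hx : x ∈ P generalizing x
  · have h1 : x ≠ 1 := fun h1 => hxD (h1 ▸ D.one_mem)
    exact this x⁻¹ (C.inv_mem hxC) (by simpa using hxD) ((hP.inv_mem_iff h1).2 hx)
  wlog hy : y ∈ P generalizing y
  · have h1 : y ≠ 1 := fun h1 => hyC (h1 ▸ C.one_mem)
    exact this y⁻¹ (D.inv_mem hyD) (by simpa using hyC) ((hP.inv_mem_iff h1).2 hy)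
  have h1 := hC.mul_mem_left hP (C.inv_mem hxC) hy hyC
  have h2 := hD.mul_mem_left hP (D.inv_mem hyD) hx hxD
  exact hP.inv_notMem h1 (by simpa using h2)

theorem pow_mem_iff (hC : IsConvex P C) (hP : IsCone P) {x : G} {n : ℕ} (hn : 0 < n) :
    x ^ n ∈ C ↔ x ∈ C := by
  refine ⟨fun h => ?_, fun h => C.pow_mem h n⟩
  by_contra hx
  wlog hxP : x ∈ P generalizing x
  · have h1 : x ≠ 1 := fun h1 => hx (h1 ▸ C.one_mem)
    exact this (x := x⁻¹) (by simpa using h) (by simpa using hx) ((hP.inv_mem_iff h1).2 hxP)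
  obtain ⟨n, rfl⟩ := Nat.exists_eq_succ_of_ne_zero hn.ne'
  rcases n.eq_zero_or_pos with rfl | hn'
  · exact hx (by simpa using h)
  · exact hx (hC hxP (hP.pow_mem hxP hn') (by rwa [← pow_succ']))

theorem bot (hP : IsCone P) : IsConvex P (⊥ : Subgroup G) := fun x hx y hy h => by
  rw [Subgroup.mem_bot] at h
  exact absurd (hP.mul_mem hx hy) (h ▸ hP.one_notMem)

theorem top : IsConvex P (⊤ : Subgroup G) := fun _ _ _ _ _ => trivial

end IsConvex

/-! ### A cone with finite conjugation orbit -/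

open Set Topology in
/-- A countable nonempty closed invariant subset of a compact Hausdorff space contains a finite
orbit. -/
theorem exists_finite_orbit {G Z : Type*} [Group G] [TopologicalSpace Z] [CompactSpace Z]
    [T2Space Z] (act : G → Z → Z) (act_one : ∀ z, act 1 z = z)
    (act_mul : ∀ g h z, act (g * h) z = act g (act h z)) (act_cont : ∀ g, Continuous (act g))
    {Y : Set Z} (hY : IsClosed Y) (hne : Y.Nonempty) (hinv : ∀ g, ∀ z ∈ Y, act g z ∈ Y)
    (hcount : Y.Countable) : ∃ y ∈ Y, (range fun g => act g y).Finite := by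
  obtain ⟨M, hMY, hM⟩ := zorn_superset_nonempty
    {S : Set Z | IsClosed S ∧ S.Nonempty ∧ ∀ g, ∀ z ∈ S, act g z ∈ S} (by
      intro c hc hchain hcne
      refine ⟨⋂₀ c, ⟨isClosed_sInter fun s hs => (hc hs).1, ?_, fun g z hz s hs =>
        (hc hs).2.2 g z (hz s hs)⟩, fun s hs => sInter_subset_of_mem hs⟩
      have := hcne.to_subtype
      rw [sInter_eq_iInter]
      refine IsCompact.nonempty_iInter_of_directed_nonempty_isCompact_isClosed _ ?_
        (fun s => (hc s.2).2.1) (fun s => (hc s.2).1.isCompact) (fun s => (hc s.2).1)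
      intro s t
      rcases hchain.total s.2 t.2 with h | h
      · exact ⟨s, subset_rfl, h⟩
      · exact ⟨t, h, subset_rfl⟩) Y ⟨hY, hne, hinv⟩
  obtain ⟨hMc, hMne, hMinv⟩ := hM.prop
  have := (hcount.mono hMY).to_subtype
  have := hMne.to_subtype
  have := isCompact_iff_compactSpace.1 hMc.isCompact
  -- Baire: the minimal set M is a countable union of singletons, so it has an isolated point y.
  obtain ⟨y, hy⟩ := nonempty_interior_of_iUnion_of_closed (f := fun m : M => ({m} : Set M))
    (fun m => isClosed_singleton) (by ext; simp)
  have hopen : IsOpen ({y} : Set M) := by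
    rw [← interior_eq_iff_isOpen]
    exact (subset_singleton_iff_eq.1 interior_subset).resolve_left hy.ne_empty
  obtain ⟨U, hU, hUy⟩ := isOpen_induced_iff.1 hopen
  have hUM : ∀ z ∈ M, z ∈ U → z = y := fun z hz hzU => by
    have : (⟨z, hz⟩ : M) ∈ ({y} : Set M) := hUy ▸ hzU
    exact congrArg Subtype.val this
  have hyU : (y : Z) ∈ U := by
    have : y ∈ Subtype.val ⁻¹' U := hUy ▸ rfl
    exact this
  -- The points of M whose orbit misses U form a closed invariant subset not containing y, so
  -- minimality makes it empty.
  have hcover : M ⊆ ⋃ g, act g ⁻¹' U := by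
    by_contra hnot
    obtain ⟨z, hzM, hzU⟩ := not_subset.1 hnot
    have hmem : M \ ⋃ g, act g ⁻¹' U ∈
        {S : Set Z | IsClosed S ∧ S.Nonempty ∧ ∀ g, ∀ z ∈ S, act g z ∈ S} := by
      refine ⟨hMc.sdiff (isOpen_iUnion fun g => hU.preimage (act_cont g)), ⟨z, hzM, hzU⟩, ?_⟩
      rintro g z ⟨hz, hz'⟩
      refine ⟨hMinv g z hz, fun h => hz' ?_⟩
      obtain ⟨k, hk⟩ := mem_iUnion.1 h
      exact mem_iUnion.2 ⟨k * g, by simpa [act_mul] using hk⟩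
    have := hM.le_of_le hmem sdiff_subset y.2
    exact this.2 (mem_iUnion.2 ⟨1, by simpa [act_one] using hyU⟩)
  obtain ⟨t, ht⟩ := hMc.isCompact.elim_finite_subcover _
    (fun g => hU.preimage (act_cont g)) hcover
  have hfin : M.Finite := by
    refine (t.finite_toSet.image fun g => act g⁻¹ y).subset fun z hz => ?_
    obtain ⟨g, hg, hzg⟩ := mem_iUnion₂.1 (ht hz)
    refine ⟨g, hg, ?_⟩
    change act g⁻¹ y = z
    rw [← hUM _ (hMinv g z hz) hzg, ← act_mul, inv_mul_cancel, act_one]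
  exact ⟨y, hMY y.2, hfin.subset (range_subset_iff.2 fun g => hMinv g y y.2)⟩

/-- If a group has countably many positive cones, and at least one, then it has one which every
element normalizes up to a power. -/
theorem exists_isCone_forall_pow_conj {G : Type*} [Group G]
    (hne : ∃ P : Set G, IsCone P) (hc : {P : Set G | IsCone P}.Countable) :
    ∃ P : Set G, IsCone P ∧
      ∀ g : G, ∃ n : ℕ, 0 < n ∧ ∀ x, g ^ n * x * (g ^ n)⁻¹ ∈ P ↔ x ∈ P := by
  classical
  let Y : Set (G → Bool) := {p | IsCone {x | p x = true}}
  have hYc : Y.Countable := by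
    refine hc.preimage_of_injOn (f := fun p : G → Bool => {x | p x = true}) ?_
    intro p _ q _ hpq
    funext x
    have := Set.ext_iff.1 hpq x
    exact Bool.eq_iff_iff.2 this
  have hYcl : IsClosed Y := by
    have : Y = {p : G → Bool | p 1 = false} ∩
        ((⋂ x, ⋂ y, {p : G → Bool | p x = false ∨ p y = false ∨ p (x * y) = true}) ∩
        ⋂ x, {p : G → Bool | x = 1 ∨ p x = true ∨ p x⁻¹ = true}) := by
      ext p
      simp only [Y, Set.mem_inter_iff, Set.mem_iInter, Set.mem_ofPred_eq]
      constructor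
      · intro h
        refine ⟨by simpa using h.one_notMem, fun x y => ?_, fun x => ?_⟩
        · by_cases hx : p x = true
          · by_cases hy : p y = true
            · exact Or.inr (Or.inr (h.mul_mem hx hy))
            · simp [hy]
          · simp [hx]
        · by_cases hx : x = 1
          · exact Or.inl hx
          · exact Or.inr (h.total hx)
      · rintro ⟨h1, h2, h3⟩
        refine ⟨by simp [h1], fun {x y} hx hy => ?_, fun {x} hx => (h3 x).resolve_left hx⟩
        have := h2 x y
        simp only [Set.mem_ofPred_eq] at hx hy ⊢
        simpa [hx, hy] using this
    rw [this]
    have hcl : ∀ (x : G) (b : Bool), IsClosed {p : G → Bool | p x = b} := fun x b =>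
      isClosed_singleton.preimage (continuous_apply x)
    refine (hcl 1 false).inter ((isClosed_iInter fun x => isClosed_iInter fun y =>
      (hcl x _).union ((hcl y _).union (hcl _ _))).inter (isClosed_iInter fun x => ?_))
    exact isClosed_const.union ((hcl x _).union (hcl _ _))
  obtain ⟨P, hP⟩ := hne
  obtain ⟨p, hp, hfin⟩ := exists_finite_orbit (G := G) (Z := G → Bool)
    (fun g p x => p (g⁻¹ * x * g)) (by simp) (by intros; simp [mul_assoc])
    (fun g => continuous_pi fun x => continuous_apply _) hYcl
    ⟨fun x => decide (x ∈ P), by simpa [Y] using hP⟩ (by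
      intro g q hq
      refine ⟨?_, fun {x y} hx hy => ?_, fun {x} hx => ?_⟩
      · simpa using hq.one_notMem
      · have := hq.mul_mem hx hy
        simpa [mul_assoc] using this
      · have := hq.total (x := g⁻¹ * x * g) (by simpa [mul_assoc, inv_mul_eq_one, eq_comm] using hx)
        simpa [mul_assoc] using this) hYc
  refine ⟨{x | p x = true}, hp, fun g => ?_⟩
  -- Pigeonhole on the finite orbit: two powers of g act equally, so g ^ (n - m) fixes the cone.
  obtain ⟨m, n, hmn, hlt⟩ : ∃ m n : ℕ, m < n ∧
      (fun x => p ((g ^ m)⁻¹ * x * g ^ m)) = (fun x => p ((g ^ n)⁻¹ * x * g ^ n)) := by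
    have := hfin.to_subtype
    obtain ⟨m, n, hne, h⟩ := Finite.exists_ne_map_eq_of_infinite
      (fun n : ℕ => (⟨_, ⟨g ^ n, rfl⟩⟩ : Set.range fun g : G => fun x => p (g⁻¹ * x * g)))
    have h' := congrArg Subtype.val h
    rcases hne.lt_or_gt with h1 | h1
    · exact ⟨m, n, h1, h'⟩
    · exact ⟨n, m, h1, h'.symm⟩
  refine ⟨n - m, by omega, fun x => ?_⟩
  have h := congrFun hlt (g ^ n * x * (g ^ n)⁻¹)
  have e : g ^ n = g ^ m * g ^ (n - m) := by rw [← pow_add]; congr 1; omega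
  have e1 : (g ^ m)⁻¹ * (g ^ n * x * (g ^ n)⁻¹) * g ^ m =
      g ^ (n - m) * x * (g ^ (n - m))⁻¹ := by
    rw [e]; group
  have e2 : (g ^ n)⁻¹ * (g ^ n * x * (g ^ n)⁻¹) * g ^ n = x := by group
  simp only [e1, e2] at h
  simp only [Set.mem_ofPred_eq, h]

/-! ### Convex jumps and finiteness of the convex chain -/

section ConvexHull

variable {G : Type*} [Group G] {P : Set G}

/-- The smallest convex subgroup containing an element. -/
def convexHullSubgroup (P : Set G) (x : G) : Subgroup G :=
  sInf {C | IsConvex P C ∧ x ∈ C}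

theorem isConvex_convexHullSubgroup (x : G) : IsConvex P (convexHullSubgroup P x) := by
  intro a ha b hb hab
  refine Subgroup.mem_sInf.2 fun C hC => hC.1 ha hb (Subgroup.mem_sInf.1 hab C hC)

theorem mem_convexHullSubgroup (x : G) : x ∈ convexHullSubgroup P x :=
  Subgroup.mem_sInf.2 fun _ hC => hC.2

theorem convexHullSubgroup_le_iff {C : Subgroup G} (hC : IsConvex P C) {x : G} :
    convexHullSubgroup P x ≤ C ↔ x ∈ C :=
  ⟨fun h => h (mem_convexHullSubgroup x), fun h => sInf_le ⟨hC, h⟩⟩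

theorem convexHullSubgroup_inv (x : G) : convexHullSubgroup P x⁻¹ = convexHullSubgroup P x := by
  simp [convexHullSubgroup]

theorem convexHullSubgroup_mul_of_mem (hP : IsCone P) {x y : G} (hx : x ∈ P) (hy : y ∈ P) :
    convexHullSubgroup P (x * y) = convexHullSubgroup P x ⊔ convexHullSubgroup P y := by
  have hc := isConvex_convexHullSubgroup (P := P)
  have hxm : x ∈ convexHullSubgroup P (x * y) := hc _ hx hy (mem_convexHullSubgroup _)
  refine le_antisymm ?_ (sup_le ((convexHullSubgroup_le_iff (hc _)).2 hxm)
    ((convexHullSubgroup_le_iff (hc _)).2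
      ((Subgroup.mul_mem_cancel_left _ hxm).1 (mem_convexHullSubgroup _))))
  rcases (hc x).le_total (hc y) hP with h | h
  · rw [sup_eq_right.2 h, convexHullSubgroup_le_iff (hc _)]
    exact mul_mem (h (mem_convexHullSubgroup x)) (mem_convexHullSubgroup y)
  · rw [sup_eq_left.2 h, convexHullSubgroup_le_iff (hc _)]
    exact mul_mem (mem_convexHullSubgroup x) (h (mem_convexHullSubgroup y))

/-- The hull behaves like an ultrametric valuation: the factor with the larger hull determines the
hull of the product. -/
theorem convexHullSubgroup_mul_eq_right (hP : IsCone P) {x y : G}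
    (hy : y ∉ convexHullSubgroup P x) :
    convexHullSubgroup P (x * y) = convexHullSubgroup P y := by
  have hc := isConvex_convexHullSubgroup (P := P)
  have hxy : convexHullSubgroup P x ≤ convexHullSubgroup P y :=
    ((hc x).le_total (hc y) hP).resolve_right fun h => hy (h (mem_convexHullSubgroup y))
  have hxy' : x * y ∉ convexHullSubgroup P x := fun h =>
    hy ((Subgroup.mul_mem_cancel_left _ (mem_convexHullSubgroup x)).1 h)
  have hx : x ∈ convexHullSubgroup P (x * y) := by
    rcases (hc x).le_total (hc (x * y)) hP with h | h
    · exact h (mem_convexHullSubgroup x)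
    · exact absurd (h (mem_convexHullSubgroup _)) hxy'
  refine le_antisymm ((convexHullSubgroup_le_iff (hc _)).2
    (mul_mem (hxy (mem_convexHullSubgroup x)) (mem_convexHullSubgroup y))) ?_
  exact (convexHullSubgroup_le_iff (hc _)).2
    ((Subgroup.mul_mem_cancel_left _ hx).1 (mem_convexHullSubgroup _))

theorem convexHullSubgroup_mul_eq_left (hP : IsCone P) {x y : G}
    (hx : x ∉ convexHullSubgroup P y) :
    convexHullSubgroup P (x * y) = convexHullSubgroup P x := by
  rw [← convexHullSubgroup_inv, mul_inv_rev, convexHullSubgroup_mul_eq_right hP,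
    convexHullSubgroup_inv]
  simpa [convexHullSubgroup_inv] using hx

/-- The cone obtained from `P` by reversing the order on the convex jumps outside `S`. -/
def flipCone (P : Set G) (S : Set (Subgroup G)) : Set G :=
  {x | x ≠ 1 ∧ (x ∈ P ↔ convexHullSubgroup P x ∈ S)}

/-- In a product, the factor with the strictly larger hull dictates both hull and sign. If the hulls
are equal, both factors have the same `P`-sign, fixed by S, and the product keeps that sign and
hull. -/
theorem isCone_flipCone (hP : IsCone P) (S : Set (Subgroup G)) : IsCone (flipCone P S) := by
  have hc := isConvex_convexHullSubgroup (P := P)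
  refine ⟨fun h => h.1 rfl, fun {x y} hx hy => ?_, fun {x} hx => ?_⟩
  · by_cases h1 : y ∈ convexHullSubgroup P x
    swap
    · rw [flipCone, Set.mem_ofPred_eq, convexHullSubgroup_mul_eq_right hP h1,
        (hc x).mul_mem_left_iff hP (mem_convexHullSubgroup x) h1]
      refine ⟨fun h => h1 ?_, hy.2⟩
      rw [← inv_eq_of_mul_eq_one_right h]
      exact inv_mem (mem_convexHullSubgroup x)
    by_cases h2 : x ∈ convexHullSubgroup P y
    swap
    · rw [flipCone, Set.mem_ofPred_eq, convexHullSubgroup_mul_eq_left hP h2,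
        (hc y).mul_mem_right_iff hP (mem_convexHullSubgroup y) h2]
      refine ⟨fun h => h2 ?_, hx.2⟩
      rw [eq_inv_of_mul_eq_one_left h]
      exact inv_mem (mem_convexHullSubgroup y)
    have he : convexHullSubgroup P x = convexHullSubgroup P y :=
      le_antisymm ((convexHullSubgroup_le_iff (hc y)).2 h2)
        ((convexHullSubgroup_le_iff (hc x)).2 h1)
    by_cases hS : convexHullSubgroup P x ∈ S
    · have hxP := hx.2.2 hS
      have hyP := hy.2.2 (he ▸ hS)
      have hxy := hP.mul_mem hxP hyP
      refine ⟨hP.ne_one hxy, iff_of_true hxy ?_⟩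
      rwa [convexHullSubgroup_mul_of_mem hP hxP hyP, ← he, sup_idem]
    · have hxP := (hP.inv_mem_iff hx.1).2 fun h => hS (hx.2.1 h)
      have hyP := (hP.inv_mem_iff hy.1).2 fun h => hS (he ▸ hy.2.1 h)
      have hxy := hP.mul_mem hyP hxP
      have h1 : x * y ∉ P := fun h => hP.inv_notMem h (by simpa using hxy)
      refine ⟨fun h => hP.ne_one hxy (by rw [← mul_inv_rev, h, inv_one]), iff_of_false h1 ?_⟩
      rwa [← convexHullSubgroup_inv, mul_inv_rev, convexHullSubgroup_mul_of_mem hP hyP hxP,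
        convexHullSubgroup_inv, convexHullSubgroup_inv, ← he, sup_idem]
  · by_cases h : x ∈ P ↔ convexHullSubgroup P x ∈ S
    · exact Or.inl ⟨hx, h⟩
    · refine Or.inr ⟨inv_ne_one.2 hx, ?_⟩
      rw [convexHullSubgroup_inv, hP.inv_mem_iff hx]
      tauto

/-- If there are only countably many cones, then every cone has finitely many convex subgroups. -/
theorem finite_isConvex (hP : IsCone P) (hc : {P : Set G | IsCone P}.Countable) :
    {C : Subgroup G | IsConvex P C}.Finite := by
  let J : Set (Subgroup G) := convexHullSubgroup P '' {x | x ≠ 1}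
  have hJ : J.Finite := by
    by_contra hJ
    have hinf : Infinite J := Set.infinite_coe_iff.2 hJ
    have hinj : Function.Injective fun S : Set J =>
        (⟨flipCone P (Subtype.val '' S), isCone_flipCone hP _⟩ : {P : Set G | IsCone P}) := by
      intro S T hST
      ext ⟨D, x, hx, rfl⟩
      have h := Set.ext_iff.1 (congrArg Subtype.val hST) x
      have hmem : ∀ S : Set J, convexHullSubgroup P x ∈ Subtype.val '' S ↔
          (⟨_, x, hx, rfl⟩ : J) ∈ S := fun S => by
        constructor
        · rintro ⟨a, ha, hax⟩
          rwa [← show a = (⟨_, x, hx, rfl⟩ : J) from Subtype.ext hax]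
        · exact fun h => ⟨_, h, rfl⟩
      simp only [flipCone, Set.mem_ofPred_eq, hmem] at h
      have hx' : x ≠ 1 := hx
      tauto
    have := hc.to_subtype
    have hS : Countable (Set J) := hinj.countable
    obtain ⟨f, hf⟩ := hS.exists_injective_nat
    exact Function.cantor_injective (fun s => Infinite.natEmbedding J (f s))
      ((Infinite.natEmbedding J).injective.comp hf)
  -- A convex subgroup is determined by the hulls of elements that it contains.
  refine Set.Finite.of_finite_image (f := fun C => {D | D ∈ J ∧ D ≤ C})
    (hJ.finite_subsets.subset ?_) ?_
  · rintro _ ⟨C, -, rfl⟩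
    exact fun D hD => hD.1
  · have key : ∀ C D : Subgroup G, IsConvex P C →
        {K | K ∈ J ∧ K ≤ C} = {K | K ∈ J ∧ K ≤ D} → C ≤ D := by
      intro C D hC h x hx
      by_cases h1 : x = 1
      · exact h1 ▸ D.one_mem
      · have : convexHullSubgroup P x ∈ {K | K ∈ J ∧ K ≤ C} :=
          ⟨⟨x, h1, rfl⟩, (convexHullSubgroup_le_iff hC).2 hx⟩
        rw [h] at this
        exact this.2 (mem_convexHullSubgroup x)
    exact fun C hC D hD h => le_antisymm (key C D hC h) (key D C hD h.symm)

/-- The finitely many convex subgroups form a finite sequence. -/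
theorem exists_convex_series (hP : IsCone P) (hfin : {C : Subgroup G | IsConvex P C}.Finite) :
    ∃ (n : ℕ) (C : ℕ → Subgroup G), C 0 = ⊥ ∧ C n = ⊤ ∧ (∀ i, IsConvex P (C i)) ∧ Monotone C ∧
      (∀ i < n, C i < C (i + 1)) ∧
      ∀ i < n, ∀ K, IsConvex P K → C i ≤ K → K ≤ C (i + 1) → K = C i ∨ K = C (i + 1) := by
  classical
  let K := {C : Subgroup G // IsConvex P C}
  let _ : Fintype K := hfin.fintype
  let _ : LinearOrder K :=
    { (inferInstance : PartialOrder K) with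
      le_total := fun a b => a.2.le_total b.2 hP
      toDecidableLE := Classical.decRel _ }
  have hpos : 0 < Fintype.card K := Fintype.card_pos_iff.2 ⟨⟨⊤, IsConvex.top⟩⟩
  obtain ⟨n, hn⟩ := Nat.exists_eq_succ_of_ne_zero hpos.ne'
  let e : Fin (n + 1) ≃o K := Fintype.orderIsoFinOfCardEq K hn
  have hlt : ∀ i, min i n < n + 1 := fun i => by omega
  -- The chain is continued by the constant ⊤ beyond n, to be indexed by ℕ.
  refine ⟨n, fun i => (e ⟨min i n, hlt i⟩).1, ?_, ?_, fun i => (e _).2, ?_, ?_, ?_⟩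
  · refine le_bot_iff.1 ?_
    have : e ⟨min 0 n, hlt 0⟩ ≤ ⟨⊥, IsConvex.bot hP⟩ := by
      rw [← e.le_symm_apply]
      exact Fin.mk_le_of_le_val (by simp)
    exact this
  · refine top_le_iff.1 ?_
    have : (⟨⊤, IsConvex.top⟩ : K) ≤ e ⟨min n n, hlt n⟩ := by
      rw [← e.symm_apply_le]
      exact Fin.le_iff_val_le_val.2 (by simpa using Fin.is_le _)
    exact this
  · intro i j hij
    have : e ⟨min i n, hlt i⟩ ≤ e ⟨min j n, hlt j⟩ := by
      rw [e.le_iff_le]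
      exact Fin.mk_le_mk.2 (by omega)
    exact this
  · intro i hi
    have : e ⟨min i n, hlt i⟩ < e ⟨min (i + 1) n, hlt (i + 1)⟩ := by
      rw [e.lt_iff_lt]
      exact Fin.mk_lt_mk.2 (by omega)
    exact this
  · intro i hi L hL h1 h2
    have h1' : e ⟨min i n, hlt i⟩ ≤ ⟨L, hL⟩ := h1
    have h2' : (⟨L, hL⟩ : K) ≤ e ⟨min (i + 1) n, hlt (i + 1)⟩ := h2
    rw [← e.le_symm_apply, Fin.le_iff_val_le_val] at h1'
    rw [← e.symm_apply_le, Fin.le_iff_val_le_val] at h2'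
    have h3 : (e.symm ⟨L, hL⟩).1 = min i n ∨ (e.symm ⟨L, hL⟩).1 = min (i + 1) n := by
      simp only at h1' h2'
      omega
    have h4 : ∀ k, (e.symm ⟨L, hL⟩).1 = min k n → L = (e ⟨min k n, hlt k⟩).1 := fun k hk => by
      have : e.symm ⟨L, hL⟩ = ⟨min k n, hlt k⟩ := Fin.ext hk
      rw [← this, e.apply_symm_apply]
    exact h3.imp (h4 _) (h4 _)

end ConvexHull

/-! ### Hölder's theorem -/

section Holder

open Filter Topology

variable {A : Type*} [Group A]

/-- Each exchange of an adjacent a, b into b, a increases a word. This replaces commutativity in the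
proof that Hölder's map is additive. -/
theorem pow_mul_pow_le_of_mul_le [LinearOrder A] [MulLeftMono A] [MulRightMono A] {a b : A}
    (h : a * b ≤ b * a) (n : ℕ) :
    a ^ n * b ^ n ≤ (a * b) ^ n ∧ (a * b) ^ n ≤ (b * a) ^ n ∧ (b * a) ^ n ≤ b ^ n * a ^ n := by
  have h1 : ∀ n, a ^ n * b ≤ b * a ^ n := by
    intro n
    induction n with
    | zero => simp
    | succ n ih =>
      calc a ^ (n + 1) * b = a * (a ^ n * b) := by rw [pow_succ', mul_assoc]
        _ ≤ a * (b * a ^ n) := mul_le_mul_right ih _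
        _ = a * b * a ^ n := by rw [mul_assoc]
        _ ≤ b * a * a ^ n := mul_le_mul_left h _
        _ = b * a ^ (n + 1) := by rw [pow_succ', mul_assoc]
  have h2 : ∀ n, a * b ^ n ≤ b ^ n * a := by
    intro n
    induction n with
    | zero => simp
    | succ n ih =>
      calc a * b ^ (n + 1) = a * b ^ n * b := by rw [pow_succ, mul_assoc]
        _ ≤ b ^ n * a * b := mul_le_mul_left ih _
        _ = b ^ n * (a * b) := by rw [mul_assoc]
        _ ≤ b ^ n * (b * a) := mul_le_mul_right h _
        _ = b ^ (n + 1) * a := by rw [pow_succ, mul_assoc]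
  refine ⟨?_, pow_le_pow_left' h n, ?_⟩
  · induction n with
    | zero => simp
    | succ n ih =>
      calc a ^ (n + 1) * b ^ (n + 1) = a * (a ^ n * b) * b ^ n := by
            rw [pow_succ', pow_succ']; simp only [mul_assoc]
        _ ≤ a * (b * a ^ n) * b ^ n := mul_le_mul_left (mul_le_mul_right (h1 n) _) _
        _ = a * b * (a ^ n * b ^ n) := by simp only [mul_assoc]
        _ ≤ a * b * (a * b) ^ n := mul_le_mul_right ih _
        _ = (a * b) ^ (n + 1) := by rw [pow_succ']
  · induction n with
    | zero => simp
    | succ n ih =>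
      calc (b * a) ^ (n + 1) = b * a * (b * a) ^ n := by rw [pow_succ']
        _ ≤ b * a * (b ^ n * a ^ n) := mul_le_mul_right ih _
        _ = b * (a * b ^ n) * a ^ n := by simp only [mul_assoc]
        _ ≤ b * (b ^ n * a) * a ^ n := mul_le_mul_left (mul_le_mul_right (h2 n) _) _
        _ = b ^ (n + 1) * a ^ (n + 1) := by rw [pow_succ', pow_succ']; simp only [mul_assoc]

/-- **Hölder's theorem**: an Archimedean bi-ordered group embeds in the reals. -/
theorem exists_hom_real_of_archimedean [LinearOrder A] [MulLeftMono A] [MulRightMono A]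
    (arch : ∀ a : A, 1 < a → ∀ b : A, ∃ n : ℕ, b < a ^ n) :
    ∃ φ : A → ℝ, (∀ x y, φ (x * y) = φ x + φ y) ∧ ∀ x, 1 < x → 0 < φ x := by
  by_cases htriv : ∀ h : A, ¬ 1 < h
  · exact ⟨fun _ => 0, by simp, fun x hx => absurd hx (htriv x)⟩
  push Not at htriv
  obtain ⟨h, hh⟩ := htriv
  have hlt : ∀ {m n : ℤ}, h ^ m < h ^ n → m < n := fun {m n} hmn => by
    by_contra! hc
    obtain ⟨k, rfl⟩ := Int.le.dest hc
    rw [zpow_add, zpow_natCast] at hmn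
    exact absurd hmn (not_lt.2 (le_mul_of_one_le_right' (one_le_pow_of_one_le' hh.le k)))
  -- The integer part f x of x in units of h is additive up to an error of 1. The homomorphism is
  -- the limit of f (x ^ n) / n, which exists by Fekete's lemma for -f.
  have hex : ∀ x : A, ∃ m : ℤ, h ^ m ≤ x ∧ x < h ^ (m + 1) := by
    intro x
    obtain ⟨n, hn⟩ := arch h hh x
    obtain ⟨k, hk⟩ := arch h hh x⁻¹
    obtain ⟨m, hm, hmax⟩ := Int.exists_greatest_of_bdd (P := fun m : ℤ => h ^ m ≤ x)
      ⟨n, fun z hz => (hlt (hz.trans_lt (by simpa using hn))).le⟩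
      ⟨-k, by simpa using (inv_lt'.1 hk).le⟩
    refine ⟨m, hm, not_le.1 fun hc => ?_⟩
    have := hmax _ hc
    omega
  choose f hf1 hf2 using hex
  have hsuper : ∀ x y, f x + f y ≤ f (x * y) := fun x y => Int.lt_add_one_iff.1 <| hlt <| by
    rw [zpow_add]
    exact (mul_le_mul' (hf1 x) (hf1 y)).trans_lt (hf2 _)
  have hsub : ∀ x y, f (x * y) ≤ f x + f y + 1 := fun x y => Int.lt_add_one_iff.1 <| hlt <| by
    have : f x + f y + 1 + 1 = f x + 1 + (f y + 1) := by ring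
    rw [this, zpow_add]
    exact (hf1 _).trans_lt (mul_lt_mul_of_lt_of_lt (hf2 x) (hf2 y))
  have hmono : ∀ {x y}, x ≤ y → f x ≤ f y := fun {x y} hxy => Int.lt_add_one_iff.1 <| hlt <|
    ((hf1 x).trans hxy).trans_lt (hf2 y)
  have hadd : ∀ x, Subadditive fun n : ℕ => -(f (x ^ n) : ℝ) := fun x m n => by
    have := hsuper (x ^ m) (x ^ n)
    rw [← pow_add] at this
    have : (f (x ^ m) : ℝ) + f (x ^ n) ≤ f (x ^ (m + n)) := by exact_mod_cast this
    linarith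
  have hbdd : ∀ x, BddBelow (Set.range fun n : ℕ => -(f (x ^ n) : ℝ) / n) := fun x => by
    have hb : ∀ n : ℕ, (f (x ^ (n + 1)) : ℝ) ≤ (n + 1) * (f x + 1) := by
      intro n
      induction n with
      | zero => simp
      | succ n ih =>
        have h1 := hsub (x ^ (n + 1)) x
        rw [← pow_succ] at h1
        have : (f (x ^ (n + 1 + 1)) : ℝ) ≤ f (x ^ (n + 1)) + f x + 1 := by exact_mod_cast h1
        push_cast
        linarith
    -- The 0 covers the term n = 0, where division by zero gives 0.
    refine ⟨min 0 (-(f x + 1)), ?_⟩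
    rintro _ ⟨n, rfl⟩
    rcases n with _ | n
    · simp
    · refine (min_le_right _ _).trans ?_
      have hn : (0 : ℝ) < (n + 1 : ℕ) := by positivity
      rw [le_div_iff₀ hn]
      have := hb n
      push_cast
      linarith
  have hlim : ∀ x, ∃ l : ℝ, Tendsto (fun n : ℕ => (f (x ^ n) : ℝ) / n) atTop (𝓝 l) := fun x =>
    ⟨_, by simpa [neg_div] using ((hadd x).tendsto_lim (hbdd x)).neg⟩
  choose φ hφ using hlim
  have hhom : ∀ x y, φ (x * y) = φ x + φ y := by
    intro x y
    have hb : ∀ n : ℕ, f (x ^ n) + f (y ^ n) ≤ f ((x * y) ^ n) ∧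
        f ((x * y) ^ n) ≤ f (x ^ n) + f (y ^ n) + 1 := by
      intro n
      rcases le_total (x * y) (y * x) with hxy | hxy
      · obtain ⟨h1, h2, h3⟩ := pow_mul_pow_le_of_mul_le hxy n
        exact ⟨(hsuper _ _).trans (hmono h1),
          ((hmono (h2.trans h3)).trans (hsub _ _)).trans (by omega)⟩
      · obtain ⟨h1, h2, h3⟩ := pow_mul_pow_le_of_mul_le hxy n
        exact ⟨(by rw [add_comm]; exact (hsuper _ _).trans (hmono (h1.trans h2))),
          (hmono h3).trans (hsub _ _)⟩
    have hsum := (hφ x).add (hφ y)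
    refine tendsto_nhds_unique (hφ (x * y)) ?_
    have hz : Tendsto (fun n : ℕ => (1 : ℝ) / n) atTop (𝓝 0) :=
      tendsto_one_div_atTop_nhds_zero_nat
    have hsum' := hsum.add hz
    rw [add_zero] at hsum'
    refine tendsto_of_tendsto_of_tendsto_of_le_of_le hsum hsum' (fun n => ?_) (fun n => ?_)
    · have : (f (x ^ n) : ℝ) + f (y ^ n) ≤ f ((x * y) ^ n) := by exact_mod_cast (hb n).1
      simp only [← add_div]
      gcongr
    · have : (f ((x * y) ^ n) : ℝ) ≤ f (x ^ n) + f (y ^ n) + 1 := by exact_mod_cast (hb n).2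
      simp only [← add_div]
      gcongr
  have hge : ∀ y, h ≤ y → 1 ≤ φ y := by
    intro y hy
    refine ge_of_tendsto (hφ y) ((eventually_gt_atTop 0).mono fun n hn => ?_)
    have hn' : (0 : ℝ) < n := by exact_mod_cast hn
    rw [le_div_iff₀ hn', one_mul]
    have : (n : ℤ) ≤ f (y ^ n) := Int.lt_add_one_iff.1 <| hlt <| by
      rw [zpow_natCast]
      exact (pow_le_pow_left' hy n).trans_lt (hf2 _)
    exact_mod_cast this
  refine ⟨φ, hhom, fun x hx => ?_⟩
  obtain ⟨k, hk⟩ := arch x hx h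
  have h1 : φ 1 = 0 := by simpa using hhom 1 1
  have hpow : ∀ k : ℕ, φ (x ^ k) = k * φ x := by
    intro k
    induction k with
    | zero => simpa using h1
    | succ k ih => rw [pow_succ, hhom, ih]; push_cast; ring
  have h2 := hge _ hk.le
  rw [hpow] at h2
  by_contra! hneg
  have : (k : ℝ) * φ x ≤ 0 := mul_nonpos_of_nonneg_of_nonpos (by positivity) hneg
  linarith

/-- Archimedean left orderings are bi-invariant. Otherwise c = b * a⁻¹ * b⁻¹ is positive. If b is
positive, some b⁻¹ * c ^ n is positive, but it is the inverse of the positive b * a ^ n. If b⁻¹ is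
positive, some b * a ^ n is positive, and then so is b * a ^ n * b⁻¹ * c ^ n = 1. -/
theorem IsCone.conj_mem_of_archimedean {Q : Set A} (hQ : IsCone Q)
    (arch : ∀ a ∈ Q, ∀ b, ∃ n : ℕ, b⁻¹ * a ^ n ∈ Q) {a : A} (ha : a ∈ Q) (b : A) :
    b * a * b⁻¹ ∈ Q := by
  by_contra hn
  have hne : b * a * b⁻¹ ≠ 1 := fun h => hQ.ne_one ha (conj_eq_one_iff.1 h)
  have hc := (hQ.inv_mem_iff hne).2 hn
  have hpow : ∀ n : ℕ, ((b * a * b⁻¹)⁻¹) ^ n = b * (a ^ n)⁻¹ * b⁻¹ := fun n => by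
    rw [inv_pow, conj_pow]; group
  have hpos : ∀ {x}, x ∈ Q → ∀ {y}, y ∈ Q → ∀ n : ℕ, y * x ^ n ∈ Q := by
    intro x hx y hy n
    rcases n.eq_zero_or_pos with rfl | h
    · simpa using hy
    · exact hQ.mul_mem hy (hQ.pow_mem hx h)
  by_cases hb1 : b = 1
  · exact hn (by simpa [hb1] using ha)
  rcases hQ.total hb1 with hb | hb
  · obtain ⟨n, h⟩ := arch _ hc b
    rw [hpow] at h
    have h' := hQ.inv_notMem (hpos ha hb n)
    exact h' (by simpa [mul_assoc] using h)
  · obtain ⟨n, h⟩ := arch _ ha b⁻¹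
    have h' := hpos hc (hQ.mul_mem h hb) n
    rw [hpow] at h'
    exact hQ.one_notMem (by simpa [mul_assoc] using h')

theorem IsCone.exists_hom_real_of_archimedean {Q : Set A} (hQ : IsCone Q)
    (arch : ∀ a ∈ Q, ∀ b, ∃ n : ℕ, b⁻¹ * a ^ n ∈ Q) :
    ∃ φ : A → ℝ, (∀ x y, φ (x * y) = φ x + φ y) ∧ ∀ x ∈ Q, 0 < φ x := by
  classical
  let o := (leftOrderingEquiv A).symm ⟨Q, hQ⟩
  have hle : ∀ a b, o.le a b ↔ a = b ∨ a⁻¹ * b ∈ Q := fun a b => Iff.rfl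
  let _ : LinearOrder A :=
    { le := o.le
      le_refl := o.le_refl
      le_trans := o.le_trans
      le_antisymm := o.le_antisymm
      le_total := o.le_total
      toDecidableLE := Classical.decRel _ }
  have hlt : ∀ a b : A, a < b ↔ a⁻¹ * b ∈ Q := by
    intro a b
    rw [lt_iff_le_and_ne]
    constructor
    · rintro ⟨h | h, h'⟩
      · exact absurd h h'
      · exact h
    · exact fun h => ⟨Or.inr h, fun h' => hQ.ne_one h (inv_mul_eq_one.2 h')⟩
  have : MulLeftMono A := ⟨fun c a b h => o.mul_left c a b h⟩
  have : MulRightMono A := ⟨fun c a b h => by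
    rcases h with rfl | h
    · exact le_rfl
    · refine Or.inr ?_
      have := hQ.conj_mem_of_archimedean arch h c⁻¹
      simpa [Function.swap, mul_assoc] using this⟩
  obtain ⟨φ, h1, h2⟩ := _root_.exists_hom_real_of_archimedean (A := A) (fun a ha b => by
    obtain ⟨n, hn⟩ := arch a (by simpa [hlt] using ha) b
    exact ⟨n, (hlt _ _).2 hn⟩)
  exact ⟨φ, h1, fun x hx => h2 x ((hlt _ _).2 (by simpa using hx))⟩

end Holder

/-! ### Convex jumps are Archimedean -/

section Jump

variable {G : Type*} [Group G] {P : Set G}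

/-- The elements lying between two powers of `h`, when conjugation by `h` preserves `P`. -/
def powerHull (hP : IsCone P) {h : G} (hh : h ∈ P) (hconj : ∀ x, h * x * h⁻¹ ∈ P ↔ x ∈ P) :
    Subgroup G where
  carrier := {x | ∃ k : ℕ, x⁻¹ * h ^ k ∈ P ∧ x * h ^ k ∈ P}
  one_mem' := ⟨1, by simpa using hh, by simpa using hh⟩
  inv_mem' := by
    rintro x ⟨k, h1, h2⟩
    exact ⟨k, by simpa using h2, h1⟩
  mul_mem' := by
    -- Invariance under h lets bounds multiply: (x * y)⁻¹ * h ^ (k + l) is y⁻¹ * h ^ l times the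
    -- conjugate of x⁻¹ * h ^ k by h ^ (-l).
    have hpow : ∀ (k : ℕ) (x : G), x ∈ P → (h ^ k)⁻¹ * x * h ^ k ∈ P := by
      intro k x hx
      induction k with
      | zero => simpa using hx
      | succ k ih =>
        rw [← hconj]
        have : h * ((h ^ (k + 1))⁻¹ * x * h ^ (k + 1)) * h⁻¹ = (h ^ k)⁻¹ * x * h ^ k := by
          rw [pow_succ]; group
        rwa [this]
    rintro x y ⟨k, h1, h2⟩ ⟨l, h3, h4⟩
    refine ⟨k + l, ?_, ?_⟩
    · have := hP.mul_mem h3 (hpow l _ h1)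
      rw [pow_add]
      simpa [mul_assoc] using this
    · have := hP.mul_mem h2 (hpow k _ h4)
      rw [add_comm, pow_add]
      simpa [mul_assoc] using this

theorem isConvex_powerHull (hP : IsCone P) {h : G} (hh : h ∈ P)
    (hconj : ∀ x, h * x * h⁻¹ ∈ P ↔ x ∈ P) : IsConvex P (powerHull hP hh hconj) := by
  rintro x hx y hy ⟨k, h1, -⟩
  have h2 := hP.mul_mem hy h1
  refine ⟨k, by simpa [mul_assoc] using h2, hP.mul_mem hx ?_⟩
  simpa [mul_assoc] using hP.mul_mem hx h2

variable {C D : Subgroup G}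

/-- Powers of an element outside `C` preserving `P` are cofinal in `D`, if `C < D` is a convex
jump. -/
theorem exists_pow_of_jump (hP : IsCone P) (hC : IsConvex P C) (hD : IsConvex P D)
    (hjump : ∀ K, IsConvex P K → C ≤ K → K ≤ D → K = C ∨ K = D)
    {h : G} (hh : h ∈ P) (hconj : ∀ x, h * x * h⁻¹ ∈ P ↔ x ∈ P) (hhD : h ∈ D) (hhC : h ∉ C)
    {x : G} (hx : x ∈ D) : ∃ k : ℕ, x⁻¹ * h ^ k ∈ P ∧ x * h ^ k ∈ P := by
  have hK := isConvex_powerHull hP hh hconj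
  have hhK : h ∈ powerHull hP hh hconj :=
    ⟨2, by simpa [pow_two] using hh, hP.mul_mem hh (hP.pow_mem hh two_pos)⟩
  have hKD : powerHull hP hh hconj ≤ D := by
    rintro y ⟨k, h1, h2⟩
    by_cases hy : y = 1
    · exact hy ▸ D.one_mem
    rcases hP.total hy with hyP | hyP
    · exact hD hyP h1 (by simpa using D.pow_mem hhD k)
    · rw [← D.inv_mem_iff]
      refine hD hyP (y := y * h ^ k) h2 (by simpa using D.pow_mem hhD k)
  have hCK : C ≤ powerHull hP hh hconj :=
    (hC.le_total hK hP).resolve_right fun h' => hhC (h' hhK)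
  rcases hjump _ hK hCK hKD with h' | h'
  · exact absurd (h' ▸ hhK) hhC
  · have : x ∈ powerHull hP hh hconj := h' ▸ hx
    exact this

/-- If g * y * g⁻¹ is outside C, and positive after inverting y, some power h of it normalizes `P`
and has cofinal powers in D. Now h ^ (-m) * g = g * y ^ (-N * m). The left side is unbounded below
as m grows, but the right side stays above g * h⁻¹, because h exceeds every element of C. -/
theorem conj_mem_of_jump (hP : IsCone P) (hC : IsConvex P C) (hD : IsConvex P D) (hCD : C ≤ D)
    (hjump : ∀ K, IsConvex P K → C ≤ K → K ≤ D → K = C ∨ K = D)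
    (hfin : ∀ g : G, ∃ n : ℕ, 0 < n ∧ ∀ x, g ^ n * x * (g ^ n)⁻¹ ∈ P ↔ x ∈ P)
    {g y : G} (hg : g ∈ D) (hy : y ∈ C) : g * y * g⁻¹ ∈ C := by
  by_contra hn
  wlog hw : g * y * g⁻¹ ∈ P generalizing y
  · refine this (C.inv_mem hy) ?_ ?_
    · rwa [← conj_inv, C.inv_mem_iff]
    · rw [← conj_inv]
      exact (hP.inv_mem_iff fun h => hn (by rw [h]; exact C.one_mem)).2 hw
  obtain ⟨N, hN, hst⟩ := hfin (g * y * g⁻¹)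
  set h := (g * y * g⁻¹) ^ N with hdef
  have hh : h ∈ P := hP.pow_mem hw hN
  have hhC : h ∉ C := fun h' => hn ((hC.pow_mem_iff hP hN).1 h')
  have hhD : h ∈ D := D.pow_mem (D.mul_mem (D.mul_mem hg (hCD hy)) (D.inv_mem hg)) N
  obtain ⟨k, hk1, hk2⟩ := exists_pow_of_jump hP hC hD hjump hh hst hhD hhC hg
  have hconj : ∀ x ∈ P, h⁻¹ * x * h ∈ P := fun x hx => by
    rw [← hst]; simpa [mul_assoc] using hx
  have hconj' : ∀ (k : ℕ), ∀ x ∈ P, h ^ k * x * (h ^ k)⁻¹ ∈ P := fun k x hx => by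
    induction k with
    | zero => simpa using hx
    | succ k ih =>
      have := (hst _).2 ih
      rw [pow_succ']
      simpa [mul_assoc] using this
  have h1 : h ^ k * g ∈ P := by simpa [mul_assoc] using hconj' k _ hk2
  have hpow : ∀ m : ℕ, h ^ m * g = g * y ^ (N * m) := fun m => by
    rw [hdef, conj_pow, conj_pow, ← pow_mul]; group
  have h2 : (y ^ (N * (2 * k + 1)))⁻¹ * h ∈ P :=
    hC.mul_mem_left hP (C.inv_mem (C.pow_mem hy _)) hh hhC
  have h3 := hconj _ hk1
  have h4 := hP.mul_mem (hP.mul_mem h1 h2) h3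
  have h5 : h ^ k * g * (y ^ (N * (2 * k + 1)))⁻¹ = (h ^ (k + 1))⁻¹ * g := by
    have := hpow (2 * k + 1)
    rw [mul_inv_eq_iff_eq_mul, mul_assoc, ← this, eq_inv_mul_iff_mul_eq, ← mul_assoc, ← pow_add]
    congr 2
    omega
  refine hP.one_notMem ?_
  have h6 : h ^ k * g * ((y ^ (N * (2 * k + 1)))⁻¹ * h) * (h⁻¹ * (g⁻¹ * h ^ k) * h) =
      h ^ k * g * (y ^ (N * (2 * k + 1)))⁻¹ * (g⁻¹ * h ^ (k + 1)) := by
    rw [pow_succ h k]; group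
  rw [h6, h5] at h4
  simpa [mul_assoc] using h4

/-- A convex jump `C < D` of a left ordering preserved, up to powers, by conjugations gives an
order-preserving homomorphism from `D` to the reals with kernel `C`. -/
theorem exists_hom_real_of_jump (hP : IsCone P) (hC : IsConvex P C) (hD : IsConvex P D)
    (hCD : C ≤ D) (hjump : ∀ K, IsConvex P K → C ≤ K → K ≤ D → K = C ∨ K = D)
    (hfin : ∀ g : G, ∃ n : ℕ, 0 < n ∧ ∀ x, g ^ n * x * (g ^ n)⁻¹ ∈ P ↔ x ∈ P) :
    ∃ φ : G → ℝ, (∀ x ∈ D, ∀ y ∈ D, φ (x * y) = φ x + φ y) ∧ (∀ x ∈ C, φ x = 0) ∧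
      ∀ x ∈ D, x ∈ P → x ∉ C → 0 < φ x := by
  classical
  let N : Subgroup D := C.subgroupOf D
  have : N.Normal := ⟨fun y hy g => conj_mem_of_jump hP hC hD hCD hjump hfin g.2 hy⟩
  let Q : Set (D ⧸ N) := {a | ∃ x : D, (x : G) ∈ P ∧ (x : G) ∉ C ∧ (x : D ⧸ N) = a}
  have hQ : IsCone Q := by
    refine ⟨?_, ?_, ?_⟩
    · rintro ⟨x, -, h1, h2⟩
      exact h1 ((QuotientGroup.eq_one_iff x).1 h2)
    · rintro _ _ ⟨x, h1, h2, rfl⟩ ⟨y, h3, h4, rfl⟩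
      exact ⟨x * y, hP.mul_mem h1 h3, fun h => h2 (hC h1 h3 h), rfl⟩
    · intro a ha
      obtain ⟨x, rfl⟩ := QuotientGroup.mk_surjective a
      have hxC : (x : G) ∉ C := fun h => ha ((QuotientGroup.eq_one_iff x).2 h)
      rcases hP.total (x := (x : G)) (fun h => hxC (h ▸ C.one_mem)) with h | h
      · exact Or.inl ⟨x, h, hxC, rfl⟩
      · exact Or.inr ⟨x⁻¹, h, by simpa using hxC, rfl⟩
  obtain ⟨φ, h1, h2⟩ := hQ.exists_hom_real_of_archimedean (by
    rintro _ ⟨x, hxP, hxC, rfl⟩ b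
    obtain ⟨y, rfl⟩ := QuotientGroup.mk_surjective b
    obtain ⟨n, hn, hst⟩ := hfin x
    have hxn : (x : G) ^ n ∈ P := hP.pow_mem hxP hn
    have hxnC : (x : G) ^ n ∉ C := fun h => hxC ((hC.pow_mem_iff hP hn).1 h)
    obtain ⟨k, hk, -⟩ := exists_pow_of_jump hP hC hD hjump hxn hst (D.pow_mem x.2 n) hxnC y.2
    -- The extra factor x ^ n keeps the element outside C: by convexity, lying in C would put x ^ n
    -- in C.
    refine ⟨n * (k + 1), y⁻¹ * x ^ (n * (k + 1)), ?_, fun h => ?_, rfl⟩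
    · have := hP.mul_mem hk hxn
      rw [mul_add, mul_one, pow_add, pow_mul]
      simpa [mul_assoc] using this
    · have h' : ((y : G)⁻¹ * ((x : G) ^ n) ^ k) * (x : G) ^ n ∈ C := by
        rw [mul_add, mul_one, pow_add, pow_mul] at h
        simpa [mul_assoc] using h
      exact hxnC ((C.mul_mem_cancel_left (hC hk hxn h')).1 h'))
  refine ⟨fun x => if h : x ∈ D then φ ((⟨x, h⟩ : D) : D ⧸ N) else 0, ?_, ?_, ?_⟩
  · intro x hx y hy
    simp only [hx, hy, D.mul_mem hx hy, dite_true]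
    exact h1 (QuotientGroup.mk ⟨x, hx⟩) (QuotientGroup.mk ⟨y, hy⟩)
  · intro x hx
    simp only [hCD hx, dite_true]
    have h3 : φ 1 = 0 := by simpa using h1 1 1
    rw [← h3]
    exact congrArg φ ((QuotientGroup.eq_one_iff _).2 hx)
  · intro x hx hxP hxC
    simp only [hx, dite_true]
    exact h2 _ ⟨⟨x, hx⟩, hxP, hxC, rfl⟩

end Jump

/-! ### Real homomorphisms on subgroups -/

/-- A real-valued function restricting to a homomorphism on a subgroup. -/
def IsHomOn {G : Type*} [Group G] (D : Subgroup G) (φ : G → ℝ) : Prop :=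
  ∀ x ∈ D, ∀ y ∈ D, φ (x * y) = φ x + φ y

namespace IsHomOn

variable {G : Type*} [Group G] {D : Subgroup G} {φ : G → ℝ}

theorem map_one (hφ : IsHomOn D φ) : φ 1 = 0 := by
  simpa using hφ 1 D.one_mem 1 D.one_mem

theorem map_inv (hφ : IsHomOn D φ) {x : G} (hx : x ∈ D) : φ x⁻¹ = -φ x := by
  have := hφ x hx x⁻¹ (D.inv_mem hx)
  rw [mul_inv_cancel, hφ.map_one] at this
  linarith

theorem map_pow (hφ : IsHomOn D φ) {x : G} (hx : x ∈ D) (n : ℕ) : φ (x ^ n) = n * φ x := by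
  induction n with
  | zero => simpa using hφ.map_one
  | succ n ih => rw [pow_succ, hφ _ (D.pow_mem hx n) _ hx, ih]; push_cast; ring

theorem map_zpow (hφ : IsHomOn D φ) {x : G} (hx : x ∈ D) (n : ℤ) : φ (x ^ n) = n * φ x := by
  obtain ⟨n, rfl | rfl⟩ := n.eq_nat_or_neg
  · simpa using hφ.map_pow hx n
  · rw [zpow_neg, zpow_natCast, hφ.map_inv (D.pow_mem hx n), hφ.map_pow hx]
    push_cast
    ring

theorem map_conj (hφ : IsHomOn D φ) {x y : G} (hx : x ∈ D) (hy : y ∈ D) :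
    φ (x * y * x⁻¹) = φ y := by
  rw [hφ _ (D.mul_mem hx hy) _ (D.inv_mem hx), hφ _ hx _ hy, hφ.map_inv hx]
  ring

/-- A homomorphism to the reals vanishing on commutators extends from a subgroup. -/
theorem exists_extension {E : Subgroup G} (hDE : D ≤ E) (hφ : IsHomOn D φ)
    (hcomm : ∀ x ∈ E, ∀ y ∈ E, x * y * x⁻¹ * y⁻¹ ∈ D ∧ φ (x * y * x⁻¹ * y⁻¹) = 0) :
    ∃ ψ : G → ℝ, IsHomOn E ψ ∧ ∀ x ∈ D, ψ x = φ x := by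
  classical
  have hcom : ∀ z : E, z ∈ commutator E → (z : G) ∈ D ∧ φ z = 0 := by
    intro z hz
    rw [commutator_eq_closure] at hz
    induction hz using Subgroup.closure_induction with
    | mem z hz =>
      obtain ⟨x, y, rfl⟩ := hz
      exact hcomm x x.2 y y.2
    | one => exact ⟨D.one_mem, hφ.map_one⟩
    | mul x y _ _ h1 h2 =>
      exact ⟨D.mul_mem h1.1 h2.1, by
        rw [Subgroup.coe_mul, hφ _ h1.1 _ h2.1, h1.2, h2.2, add_zero]⟩
    | inv x _ h =>
      exact ⟨D.inv_mem h.1, by rw [Subgroup.coe_inv, hφ.map_inv h.1, h.2, neg_zero]⟩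
  -- φ descends to the image of D in the abelianization of E and extends from there, since the
  -- divisible group ℝ is injective.
  let B := Additive (Abelianization E)
  let q : E → B := fun x => Additive.ofMul (Abelianization.of x)
  have hqmul : ∀ x y, q (x * y) = q x + q y := fun x y => by
    simp [q]
  have hq1 : q 1 = 0 := by simp [q]
  have hqinv : ∀ x, q x⁻¹ = -q x := fun x => by simp [q]
  have hqeq : ∀ x y : E, (x : G) ∈ D → (y : G) ∈ D → q x = q y → φ x = φ y := by
    intro x y hx hy hxy
    have h1 : x⁻¹ * y ∈ commutator E := by
      have : Abelianization.of x = Abelianization.of y := hxy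
      exact QuotientGroup.eq.1 this
    have h2 := (hcom _ h1).2
    rw [Subgroup.coe_mul, Subgroup.coe_inv, hφ _ (D.inv_mem hx) _ hy, hφ.map_inv hx] at h2
    linarith
  let M : AddSubgroup B :=
    { carrier := {b | ∃ x : E, (x : G) ∈ D ∧ q x = b}
      zero_mem' := ⟨1, D.one_mem, hq1⟩
      add_mem' := by
        rintro _ _ ⟨x, hx, rfl⟩ ⟨y, hy, rfl⟩
        exact ⟨x * y, D.mul_mem hx hy, hqmul x y⟩
      neg_mem' := by
        rintro _ ⟨x, hx, rfl⟩
        exact ⟨x⁻¹, D.inv_mem hx, hqinv x⟩ }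
  choose r hrD hr using fun m : M => m.2
  let f : M →+ ℝ := AddMonoidHom.mk' (fun m => φ (r m)) (fun a b => by
    rw [← hφ _ (hrD a) _ (hrD b)]
    refine hqeq _ (r a * r b) (hrD _) (D.mul_mem (hrD a) (hrD b)) ?_
    rw [hr, hqmul, hr, hr]
    rfl)
  obtain ⟨F, hF⟩ := (Module.Baer.of_divisible ℝ).extension_property_addMonoidHom M.subtype
    M.subtype_injective f
  refine ⟨fun x => if h : x ∈ E then F (q ⟨x, h⟩) else 0, ?_, ?_⟩
  · intro x hx y hy
    simp only [hx, hy, E.mul_mem hx hy, dite_true]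
    rw [← map_add, ← hqmul]
    rfl
  · intro x hx
    simp only [hDE hx, dite_true]
    have h1 := DFunLike.congr_fun hF ⟨q ⟨x, hDE hx⟩, ⟨x, hDE hx⟩, hx, rfl⟩
    refine h1.trans ?_
    exact hqeq _ ⟨x, hDE hx⟩ (hrD _) hx (hr _)

end IsHomOn

/-! ### Uncountable families of cones from actions on the line -/

section Construction

variable {G : Type*} [Group G] {P : Set G} {D E : Subgroup G}

/-- The cone equal to `P` outside `D`, and given in `D` by the action `ρ` on the orbit of `s`. -/
def actionCone (P : Set G) (D : Subgroup G) (ρ : G → ℝ → ℝ) (s : ℝ) : Set G :=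
  {x | (x ∉ D ∧ x ∈ P) ∨ (x ∈ D ∧ (s < ρ x s ∨ (ρ x s = s ∧ x ∈ P)))}

/-- Inside D, x is positive when it moves s to the right, with `P` deciding on the stabilizer of s.
Convexity makes signs outside D insensitive to multiplication by D. -/
theorem isCone_actionCone (hP : IsCone P) (hD : IsConvex P D) {ρ : G → ℝ → ℝ} (s : ℝ)
    (h1 : ∀ r, ρ 1 r = r) (hmul : ∀ x ∈ D, ∀ y ∈ D, ∀ r, ρ (x * y) r = ρ x (ρ y r))
    (hmono : ∀ x ∈ D, StrictMono (ρ x)) : IsCone (actionCone P D ρ s) := by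
  refine ⟨?_, ?_, ?_⟩
  · rintro (⟨h, -⟩ | ⟨-, h | ⟨-, h⟩⟩)
    · exact h D.one_mem
    · exact h.ne' (h1 s)
    · exact hP.one_notMem h
  · rintro x y (⟨hx, hxP⟩ | ⟨hx, hx'⟩) (⟨hy, hyP⟩ | ⟨hy, hy'⟩)
    · exact Or.inl ⟨fun h => hx (hD hxP hyP h), hP.mul_mem hxP hyP⟩
    · exact Or.inl ⟨fun h => hx ((D.mul_mem_cancel_right hy).1 h), hD.mul_mem_right hP hy hxP hx⟩
    · exact Or.inl ⟨fun h => hy ((D.mul_mem_cancel_left hx).1 h), hD.mul_mem_left hP hx hyP hy⟩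
    · refine Or.inr ⟨D.mul_mem hx hy, ?_⟩
      rw [hmul x hx y hy]
      rcases hy' with hy' | ⟨hy', hyP⟩
      · left
        have := hmono x hx hy'
        rcases hx' with hx' | ⟨hx', -⟩
        · exact hx'.trans this
        · rwa [hx'] at this
      · rw [hy']
        exact hx'.imp id fun h => ⟨h.1, hP.mul_mem h.2 hyP⟩
  · intro x hx
    by_cases hxD : x ∈ D
    · have hxi : ρ x⁻¹ (ρ x s) = s := by
        rw [← hmul _ (D.inv_mem hxD) _ hxD, inv_mul_cancel, h1]
      rcases lt_trichotomy s (ρ x s) with h | h | h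
      · exact Or.inl (Or.inr ⟨hxD, Or.inl h⟩)
      · rw [← h] at hxi
        rcases hP.total hx with h' | h'
        · exact Or.inl (Or.inr ⟨hxD, Or.inr ⟨h.symm, h'⟩⟩)
        · exact Or.inr (Or.inr ⟨D.inv_mem hxD, Or.inr ⟨hxi, h'⟩⟩)
      · refine Or.inr (Or.inr ⟨D.inv_mem hxD, Or.inl ?_⟩)
        have := hmono _ (D.inv_mem hxD) h
        rwa [hxi] at this
    · exact (hP.total hx).imp (fun h => Or.inl ⟨hxD, h⟩)
        fun h => Or.inl ⟨by simpa using hxD, h⟩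

/-- Real-parametrized families of actions giving pairwise distinct cones do not exist if there are
only countably many cones. -/
theorem false_of_separated_actions (hP : IsCone P) (hc : {P : Set G | IsCone P}.Countable)
    (hD : IsConvex P D) (ρ : ℝ → G → ℝ → ℝ) (s : ℝ → ℝ)
    (h1 : ∀ t r, ρ t 1 r = r) (hmul : ∀ t, ∀ x ∈ D, ∀ y ∈ D, ∀ r, ρ t (x * y) r = ρ t x (ρ t y r))
    (hmono : ∀ t, ∀ x ∈ D, StrictMono (ρ t x))
    (hsep : ∀ t t', t < t' → ∃ x ∈ D, ρ t x (s t) < s t ∧ s t' < ρ t' x (s t')) : False := by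
  have hlt : ∀ t t', t < t' → actionCone P D (ρ t) (s t) ≠ actionCone P D (ρ t') (s t') := by
    intro t t' htt h
    obtain ⟨x, hx, h2, h3⟩ := hsep t t' htt
    have h4 : x ∈ actionCone P D (ρ t') (s t') := Or.inr ⟨hx, Or.inl h3⟩
    rw [← h] at h4
    rcases h4 with ⟨h5, -⟩ | ⟨-, h5 | ⟨h5, -⟩⟩
    · exact h5 hx
    · exact lt_asymm h5 h2
    · exact h2.ne h5
  have hinj : Function.Injective fun t : ℝ => (⟨actionCone P D (ρ t) (s t),
      isCone_actionCone hP hD _ (h1 t) (hmul t) (hmono t)⟩ : {P : Set G | IsCone P}) := by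
    intro t t' h
    by_contra hne
    have h' := congrArg Subtype.val h
    rcases lt_or_gt_of_ne hne with h2 | h2
    · exact hlt _ _ h2 h'
    · exact hlt _ _ h2 h'.symm
  have := hc.to_subtype
  exact Cardinal.not_countable_real (Set.countable_univ_iff.2 hinj.countable)

/-- With countably many cones, homomorphisms from a convex subgroup to the reals are
proportional. -/
theorem IsHomOn.proportional (hP : IsCone P) (hc : {P : Set G | IsCone P}.Countable)
    (hD : IsConvex P D) {φ ψ : G → ℝ} (hφ : IsHomOn D φ) (hψ : IsHomOn D ψ)
    {a b : G} (ha : a ∈ D) (hb : b ∈ D) : φ a * ψ b = φ b * ψ a := by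
  have key : ∀ φ ψ : G → ℝ, IsHomOn D φ → IsHomOn D ψ → φ a = 1 → φ b = 0 → ψ a = 0 → ψ b = 1 →
      False := by
    intro φ ψ hφ hψ h1 h2 h3 h4
    refine false_of_separated_actions hP hc hD (fun t x r => r + (φ x + t * ψ x)) (fun _ => 0)
      (fun t r => by rw [hφ.map_one, hψ.map_one]; ring)
      (fun t x hx y hy r => by rw [hφ x hx y hy, hψ x hx y hy]; ring)
      (fun t x _ r r' h => by simpa using h) ?_
    intro t t' htt
    obtain ⟨q, hq1, hq2⟩ := exists_rat_btwn htt
    have hqd : (0 : ℝ) < q.den := by exact_mod_cast q.den_pos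
    have hq : (q : ℝ) = q.num / q.den := Rat.cast_def q
    rw [hq, lt_div_iff₀ hqd] at hq1
    rw [hq, div_lt_iff₀ hqd] at hq2
    -- Its translation length for parameter t is q.den * (t - q), which changes sign between t and
    -- t'.
    refine ⟨a ^ (-q.num) * b ^ q.den, D.mul_mem (D.zpow_mem ha _) (D.pow_mem hb _), ?_⟩
    rw [hφ _ (D.zpow_mem ha _) _ (D.pow_mem hb _), hψ _ (D.zpow_mem ha _) _ (D.pow_mem hb _),
      hφ.map_zpow ha, hφ.map_pow hb, hψ.map_zpow ha, hψ.map_pow hb, h1, h2, h3, h4]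
    push_cast
    constructor <;> linarith
  -- Cramer's rule replaces φ, ψ by the combinations dual to a, b.
  by_contra hne
  have hdet : φ a * ψ b - φ b * ψ a ≠ 0 := sub_ne_zero.2 hne
  set d := φ a * ψ b - φ b * ψ a with hd
  refine key (fun x => (ψ b * φ x - φ b * ψ x) / d) (fun x => (φ a * ψ x - ψ a * φ x) / d)
    (fun x hx y hy => by simp only [hφ x hx y hy, hψ x hx y hy]; ring)
    (fun x hx y hy => by simp only [hφ x hx y hy, hψ x hx y hy]; ring) ?_ ?_ ?_ ?_
  · rw [div_eq_one_iff_eq hdet, hd]; ring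
  · simp only [div_eq_zero_iff]; left; ring
  · simp only [div_eq_zero_iff]; left; ring
  · rw [div_eq_one_iff_eq hdet, hd]; ring

/-- With countably many cones, the image of a homomorphism from a convex subgroup to the reals has
rank one. -/
theorem IsHomOn.exists_nat_mul_eq (hP : IsCone P) (hc : {P : Set G | IsCone P}.Countable)
    (hD : IsConvex P D) {φ : G → ℝ} (hφ : IsHomOn D φ) {a b : G} (ha : a ∈ D) (hb : b ∈ D)
    (ha0 : 0 < φ a) (hb0 : 0 < φ b) : ∃ m k : ℕ, 0 < m ∧ 0 < k ∧ m * φ a = k * φ b := by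
  have hspan : φ a ∈ Submodule.span ℚ {φ b} := by
    by_contra hn
    -- Composing φ with a ℚ-linear functional killing φ b but not φ a gives a homomorphism not
    -- proportional to φ.
    obtain ⟨f, hf, hle⟩ := Submodule.exists_le_ker_of_notMem hn
    have hfb : f (φ b) = 0 := hle (Submodule.mem_span_singleton_self _)
    have := hφ.proportional hP hc hD (ψ := fun x => (f (φ x) : ℝ))
      (fun x hx y hy => by simp only [hφ x hx y hy, map_add]; push_cast; rfl) ha hb
    simp only [hfb, Rat.cast_zero, mul_zero] at this
    rcases mul_eq_zero.1 this.symm with h | h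
    · exact hb0.ne' h
    · exact hf (by exact_mod_cast h)
  obtain ⟨q, hq⟩ := Submodule.mem_span_singleton.1 hspan
  have hq' : (q : ℝ) * φ b = φ a := by rw [← hq, Rat.smul_def]
  have hqpos : 0 < q := by
    have : (0 : ℝ) < q := by
      by_contra! h
      have := mul_nonpos_of_nonpos_of_nonneg h hb0.le
      linarith
    exact_mod_cast this
  obtain ⟨k, hk⟩ := Int.eq_ofNat_of_zero_le (Rat.num_pos.2 hqpos).le
  have hk0 : 0 < k := by
    have := Rat.num_pos.2 hqpos
    omega
  refine ⟨q.den, k, q.den_pos, hk0, ?_⟩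
  have hqd : (q.den : ℝ) ≠ 0 := by exact_mod_cast q.den_pos.ne'
  have h2 : (q : ℝ) = k / q.den := by
    rw [Rat.cast_def, hk]; simp
  rw [← hq', h2]
  field_simp

/-- If `E` acts on `φ` by positive scalars, not all `1`, then there are uncountably many cones, from
affine actions of `E` on the line. -/
theorem false_of_scaling (hP : IsCone P) (hc : {P : Set G | IsCone P}.Countable)
    (hE : IsConvex P E) (hDE : D ≤ E) {φ l : G → ℝ} (hφ : IsHomOn D φ)
    (hconj : ∀ g ∈ E, ∀ x ∈ D, g * x * g⁻¹ ∈ D ∧ φ (g * x * g⁻¹) = l g * φ x)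
    (hpos : ∀ g ∈ E, 0 < l g) (hcomm : ∀ x ∈ E, ∀ y ∈ E, x * y * x⁻¹ * y⁻¹ ∈ D)
    {c t : G} (hcD : c ∈ D) (hc0 : φ c ≠ 0) (ht : t ∈ E) (ht1 : l t ≠ 1) : False := by
  have hl1 : ∀ x ∈ D, l x = 1 := fun x hx => by
    have := (hconj x (hDE hx) c hcD).2
    rw [hφ.map_conj hx hcD] at this
    exact (mul_eq_right₀ hc0).1 this.symm
  have hlmul : ∀ x ∈ E, ∀ y ∈ E, l (x * y) = l x * l y := by
    intro x hx y hy
    have h1 := (hconj (x * y) (E.mul_mem hx hy) c hcD).2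
    have h2 := (hconj x hx _ (hconj y hy c hcD).1).2
    rw [(hconj y hy c hcD).2] at h2
    have h3 : x * y * c * (x * y)⁻¹ = x * (y * c * y⁻¹) * x⁻¹ := by group
    rw [h3, h2, ← mul_assoc] at h1
    exact (mul_right_cancel₀ hc0 h1).symm
  wlog ht2 : l t < 1 generalizing t
  · have h1 := hlmul t ht t⁻¹ (E.inv_mem ht)
    rw [mul_inv_cancel, hl1 1 D.one_mem] at h1
    have h2 : 1 < l t := lt_of_le_of_ne (not_lt.1 ht2) ht1.symm
    have h3 : l t⁻¹ < 1 := by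
      have := hpos _ (E.inv_mem ht)
      nlinarith
    exact this (E.inv_mem ht) h3.ne h3
  have hd : 1 - l t ≠ 0 := by linarith
  -- This is forced: a cocycle extending φ with β t = 0 must satisfy it, by a * t = [a, t] * t * a.
  let β : G → ℝ := fun a => φ (a * t * a⁻¹ * t⁻¹) / (1 - l t)
  have hβmul : ∀ a ∈ E, ∀ b ∈ E, β (a * b) = β a + l a * β b := by
    intro a ha b hb
    have h1 : a * b * t * (a * b)⁻¹ * t⁻¹ =
        a * (b * t * b⁻¹ * t⁻¹) * a⁻¹ * (a * t * a⁻¹ * t⁻¹) := by group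
    have h2 := hconj a ha _ (hcomm b hb t ht)
    simp only [β]
    rw [h1, hφ _ h2.1 _ (hcomm a ha t ht), h2.2]
    ring
  have hβD : ∀ a ∈ D, β a = φ a := by
    intro a ha
    have h2 := hconj t ht _ (D.inv_mem ha)
    have h1 : a * t * a⁻¹ * t⁻¹ = a * (t * a⁻¹ * t⁻¹) := by group
    simp only [β]
    rw [h1, hφ _ ha _ h2.1, h2.2, hφ.map_inv ha]
    field_simp
    ring
  have hβt : β t = 0 := by
    simp [β, hφ.map_one]
  have hsmall : ∀ ε > 0, ∃ a ∈ D, 0 < φ a ∧ φ a < ε := by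
    intro ε hε
    have hpow : ∀ k : ℕ, ∃ a ∈ D, φ a = l t ^ k * |φ c| := by
      intro k
      induction k with
      | zero =>
        rcases abs_choice (φ c) with h | h
        · exact ⟨c, hcD, by simp [h]⟩
        · exact ⟨c⁻¹, D.inv_mem hcD, by rw [hφ.map_inv hcD]; simp [h]⟩
      | succ k ih =>
        obtain ⟨a, ha, hφa⟩ := ih
        exact ⟨_, (hconj t ht a ha).1, by rw [(hconj t ht a ha).2, hφa]; ring⟩
    obtain ⟨k, hk⟩ := exists_pow_lt_of_lt_one (div_pos hε (abs_pos.2 hc0)) ht2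
    obtain ⟨a, ha, hφa⟩ := hpow k
    refine ⟨a, ha, ?_, ?_⟩
    · rw [hφa]
      exact mul_pos (pow_pos (hpos t ht) k) (abs_pos.2 hc0)
    · rw [hφa]
      exact (lt_div_iff₀ (abs_pos.2 hc0)).1 hk
  have hdense : ∀ s s' : ℝ, s < s' → ∃ a ∈ D, s < φ a ∧ φ a < s' := by
    intro s s' hs
    obtain ⟨a, ha, h1, h2⟩ := hsmall (s' - s) (by linarith)
    refine ⟨a ^ (⌊s / φ a⌋ + 1), D.zpow_mem ha _, ?_, ?_⟩
    · rw [hφ.map_zpow ha, ← div_lt_iff₀ h1]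
      push_cast
      exact Int.lt_floor_add_one _
    · rw [hφ.map_zpow ha]
      have := (le_div_iff₀ h1).1 (Int.floor_le (s / φ a))
      push_cast
      linarith
  refine false_of_separated_actions hP hc hE (fun _ x r => l x * r + β x) (fun s => -s)
    (fun _ r => by rw [hl1 1 D.one_mem, hβD 1 D.one_mem, hφ.map_one]; ring)
    (fun _ x hx y hy r => by rw [hlmul x hx y hy, hβmul x hx y hy]; ring)
    (fun _ x hx r r' h => by
      have := mul_lt_mul_of_pos_left h (hpos x hx)
      simpa using this) ?_
  intro s s' hs
  -- The conjugate a * t * a⁻¹ contracts the line towards its fixed point φ a, so a fixed point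
  -- between the two base points moves them in opposite directions.
  obtain ⟨a, ha, h1, h2⟩ := hdense (-s') (-s) (by linarith)
  have haE := hDE ha
  have hat := E.mul_mem haE ht
  have hai := E.inv_mem haE
  refine ⟨a * t * a⁻¹, E.mul_mem hat hai, ?_⟩
  rw [hlmul _ hat _ hai, hlmul _ haE _ ht, hβmul _ hat _ hai, hβmul _ haE _ ht,
    hlmul _ haE _ ht, hl1 a ha, hl1 _ (D.inv_mem ha), hβD a ha, hβD _ (D.inv_mem ha),
    hφ.map_inv ha, hβt]
  constructor <;> nlinarith

/-- If `E` acts trivially on `φ`, then `φ` extends to `E`, giving two homomorphisms that are not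
proportional. -/
theorem false_of_central (hP : IsCone P) (hc : {P : Set G | IsCone P}.Countable)
    (hE : IsConvex P E) (hDE : D ≤ E) {φ φ' : G → ℝ} (hφ : IsHomOn D φ) (hφ' : IsHomOn E φ')
    (hker : ∀ x ∈ E, φ' x = 0 ↔ x ∈ D)
    (hconj : ∀ g ∈ E, ∀ x ∈ D, g * x * g⁻¹ ∈ D ∧ φ (g * x * g⁻¹) = φ x)
    {c b : G} (hcD : c ∈ D) (hc0 : φ c ≠ 0) (hb : b ∈ E) (hbD : b ∉ D) : False := by
  have hcomm : ∀ x ∈ E, ∀ y ∈ E, x * y * x⁻¹ * y⁻¹ ∈ D := by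
    intro x hx y hy
    have h1 := E.mul_mem hx hy
    have h2 := E.mul_mem h1 (E.inv_mem hx)
    rw [← hker _ (E.mul_mem h2 (E.inv_mem hy)), hφ' _ h2 _ (E.inv_mem hy), hφ'.map_conj hx hy,
      hφ'.map_inv hy]
    ring
  have hzero : ∀ x ∈ E, ∀ y ∈ E, φ (x * y * x⁻¹ * y⁻¹) = 0 := by
    intro x hx y hy
    by_cases hyD : y ∈ D
    · have := hconj x hx y hyD
      rw [hφ _ this.1 _ (D.inv_mem hyD), this.2, hφ.map_inv hyD]
      ring
    -- It is proportional to φ' and vanishes at y, where φ' does not; hence it is zero.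
    · have hω : IsHomOn E fun x => φ (x * y * x⁻¹ * y⁻¹) := by
        intro u hu v hv
        have h1 : u * v * y * (u * v)⁻¹ * y⁻¹ =
          u * (v * y * v⁻¹ * y⁻¹) * u⁻¹ * (u * y * u⁻¹ * y⁻¹) := by group
        have h2 := hconj u hu _ (hcomm v hv y hy)
        simp only [h1]
        rw [hφ _ h2.1 _ (hcomm u hu y hy), h2.2, add_comm]
      have h3 := hω.proportional hP hc hE hφ' hx hy
      have h4 : φ (y * y * y⁻¹ * y⁻¹) = 0 := by simpa using hφ.map_one
      rw [h4, zero_mul] at h3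
      exact (mul_eq_zero.1 h3).resolve_right fun h => hyD ((hker y hy).1 h)
  obtain ⟨ψ, hψ, hψφ⟩ := hφ.exists_extension hDE fun x hx y hy => ⟨hcomm x hx y hy, hzero x hx y hy⟩
  have h := hφ'.proportional hP hc hE hψ hb (hDE hcD)
  rw [(hker c (hDE hcD)).2 hcD, zero_mul, hψφ c hcD] at h
  rcases mul_eq_zero.1 h with h | h
  · exact hbD ((hker b hb).1 h)
  · exact hc0 h

end Construction

/-! ### Rigidity from sign-reversing elements -/

section Rigidity

variable {G : Type*} [Group G] {P Q : Set G} {C D E : Subgroup G}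

/-- If conjugation by a `Q`-positive `g` reverses the signs of the elements of `D \ C`, then `g` is
larger than all of `D`. -/
theorem mul_mem_of_reversing (hQ : IsCone Q) (hCD : C < D) {g : G}
    (hg : g ∈ Q) (hgD : g ∉ D) (hrev : ∀ x ∈ D, x ∉ C → (g⁻¹ * x * g ∈ Q ↔ x ∉ Q)) {d : G}
    (hd : d ∈ D) : d * g ∈ Q := by
  -- Otherwise g⁻¹ * x is positive, and so is g⁻¹ * x⁻¹ * g by reversal; their product is g⁻¹.
  have h1 : ∀ x ∈ D, x ∉ C → x ∈ Q → x⁻¹ * g ∈ Q := by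
    intro x hx hxC hxQ
    by_contra hn
    have hne : x⁻¹ * g ≠ 1 := fun h => hgD (by rwa [← inv_mul_eq_one.1 h])
    have h2 := (hQ.inv_mem_iff hne).2 hn
    have h3 := (hrev x⁻¹ (D.inv_mem hx) (by simpa using hxC)).2 (hQ.inv_notMem hxQ)
    exact hQ.inv_notMem hg (by simpa [mul_assoc] using hQ.mul_mem h3 h2)
  have h2 : ∀ x ∈ D, x ∉ C → x * g ∈ Q := by
    intro x hx hxC
    have hx1 : x ≠ 1 := fun h => hxC (h ▸ C.one_mem)
    rcases hQ.total hx1 with h | h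
    · exact hQ.mul_mem h hg
    · simpa using h1 _ (D.inv_mem hx) (by simpa using hxC) h
  by_cases hdC : d ∈ C
  swap
  · exact h2 d hd hdC
  obtain ⟨e, heD, heC⟩ := SetLike.exists_of_lt hCD
  wlog he : e ∈ Q generalizing e
  · have he1 : e ≠ 1 := fun h => heC (h ▸ C.one_mem)
    exact this e⁻¹ (D.inv_mem heD) (by simpa using heC) ((hQ.inv_mem_iff he1).2 he)
  have h3 := h2 (e⁻¹ * d) (D.mul_mem (D.inv_mem heD) hd)
    fun h => heC (by simpa using (C.mul_mem_cancel_right hdC).1 h)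
  simpa [mul_assoc] using hQ.mul_mem he h3

theorem pow_mul_mem_of_reversing (hQ : IsCone Q) [hD : D.Normal] (hCD : C < D)
    {g : G} (hg : g ∈ Q) (hgD : g ∉ D)
    (hrev : ∀ x ∈ D, x ∉ C → (g⁻¹ * x * g ∈ Q ↔ x ∉ Q)) {d : G} (hd : d ∈ D) {k : ℕ}
    (hk : 0 < k) : g ^ k * d ∈ Q := by
  have h1 := mul_mem_of_reversing hQ hCD hg hgD hrev (hD.conj_mem d hd g)
  have h2 : g * d ∈ Q := by simpa using h1
  obtain ⟨k, rfl⟩ := Nat.exists_eq_succ_of_ne_zero hk.ne'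
  rcases k.eq_zero_or_pos with rfl | hk'
  · simpa using h2
  · rw [Nat.succ_eq_add_one, pow_succ, mul_assoc]
    exact hQ.mul_mem (hQ.pow_mem hg hk') h2

/-- The cones `P` and `Q` agree up to a global sign on `D \ C`. -/
def AgreeUpToSign (P Q : Set G) (C D : Subgroup G) : Prop :=
  (∀ x ∈ D, x ∉ C → (x ∈ Q ↔ x ∈ P)) ∨ ∀ x ∈ D, x ∉ C → (x ∈ Q ↔ x ∉ P)

theorem agreeUpToSign_of_forall_mem (hP : IsCone P) (hQ : IsCone Q)
    (h : (∀ x ∈ D, x ∉ C → x ∈ P → x ∈ Q) ∨ ∀ x ∈ D, x ∉ C → x ∈ P → x ∉ Q) :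
    AgreeUpToSign P Q C D := by
  have hne : ∀ x ∉ C, x ≠ 1 := fun x hx h => hx (h ▸ C.one_mem)
  refine h.imp (fun h x hx hxC => ⟨fun hxQ => ?_, h x hx hxC⟩)
    fun h x hx hxC => ⟨fun hxQ hxP => h x hx hxC hxP hxQ, fun hxP => ?_⟩
  · by_contra hn
    exact hQ.inv_notMem hxQ (h x⁻¹ (D.inv_mem hx) (by simpa using hxC)
      ((hP.inv_mem_iff (hne x hxC)).2 hn))
  · by_contra hn
    exact h x⁻¹ (D.inv_mem hx) (by simpa using hxC) ((hP.inv_mem_iff (hne x hxC)).2 hxP)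
      ((hQ.inv_mem_iff (hne x hxC)).2 hn)

/-- Agreement up to sign propagates along a jump having a sign-reversing element. -/
theorem AgreeUpToSign.step (hP : IsCone P) (hQ : IsCone Q) [hC : C.Normal] [hD : D.Normal]
    (hCD : C < D) (h : AgreeUpToSign P Q C D) {g : G} (hgE : g ∈ E) (hgD : g ∉ D)
    (hrev : ∀ x ∈ D, x ∉ C → (g * x * g⁻¹ ∈ P ↔ x ∉ P))
    (hrank : ∀ x ∈ E, x ∉ D → x ∈ P → ∀ y ∈ E, y ∉ D → y ∈ P →
      ∃ m k : ℕ, 0 < m ∧ 0 < k ∧ ∃ d ∈ D, x ^ m = y ^ k * d) :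
    AgreeUpToSign P Q D E := by
  have hmem : ∀ u x : G, x ∈ D → x ∉ C → u * x * u⁻¹ ∈ D ∧ u * x * u⁻¹ ∉ C := fun u x hx hxC =>
    ⟨hD.conj_mem x hx u, fun h => hxC (by simpa [mul_assoc] using hC.conj_mem _ h u⁻¹)⟩
  wlog hgP : g ∈ P generalizing g
  · have hg1 : g ≠ 1 := fun h => hgD (h ▸ D.one_mem)
    refine this (g := g⁻¹) (E.inv_mem hgE) (by simpa using hgD) (fun x hx hxC => ?_)
      ((hP.inv_mem_iff hg1).2 hgP)
    have h1 := hmem g⁻¹ x hx hxC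
    have h2 := hrev _ h1.1 h1.2
    simp only [inv_inv] at h2 ⊢
    have h3 : g * (g⁻¹ * x * g) * g⁻¹ = x := by group
    rw [h3] at h2
    tauto
  have hrevQ : ∀ x ∈ D, x ∉ C → (g * x * g⁻¹ ∈ Q ↔ x ∉ Q) := by
    intro x hx hxC
    have h1 := hmem g x hx hxC
    rcases h with h | h
    · rw [h _ h1.1 h1.2, h x hx hxC, hrev x hx hxC]
    · rw [h _ h1.1 h1.2, h x hx hxC, hrev x hx hxC]
  have hrevQ' : ∀ x ∈ D, x ∉ C → (g⁻¹ * x * g ∈ Q ↔ x ∉ Q) := by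
    intro x hx hxC
    have h1 := hmem g⁻¹ x hx hxC
    rw [inv_inv] at h1
    have h2 := hrevQ _ h1.1 h1.2
    have h3 : g * (g⁻¹ * x * g) * g⁻¹ = x := by group
    rw [h3] at h2
    tauto
  have hg1 : g ≠ 1 := hP.ne_one hgP
  refine agreeUpToSign_of_forall_mem hP hQ ?_
  -- By rank one, some positive power of x is a positive power of g up to D, and D cannot affect its
  -- `Q`-sign. So the sign of g decides.
  by_cases hgQ : g ∈ Q
  · refine Or.inl fun x hx hxD hxP => ?_
    obtain ⟨m, k, hm, hk, d, hd, he⟩ := hrank x hx hxD hxP g hgE hgD hgP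
    rw [← hQ.pow_mem_iff hm, he]
    exact pow_mul_mem_of_reversing hQ hCD hgQ hgD hrevQ' hd hk
  · refine Or.inr fun x hx hxD hxP hxQ => ?_
    obtain ⟨m, k, hm, hk, d, hd, he⟩ := hrank x hx hxD hxP g hgE hgD hgP
    have h1 := pow_mul_mem_of_reversing hQ hCD ((hQ.inv_mem_iff hg1).2 hgQ) (by simpa using hgD)
      (by simpa using hrevQ) (hD.conj_mem _ (D.inv_mem hd) (g ^ k)) hk
    have h2 : g⁻¹ ^ k * (g ^ k * d⁻¹ * (g ^ k)⁻¹) = (x ^ m)⁻¹ := by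
      rw [he]; group
    rw [h2] at h1
    exact hQ.inv_notMem (hQ.pow_mem hxQ hm) h1

end Rigidity

/-! ### Conclusion -/

/-- A group with countably many positive cones has finitely many. -/
theorem finite_setOf_isCone {G : Type*} [Group G] (hc : {P : Set G | IsCone P}.Countable) :
    {P : Set G | IsCone P}.Finite := by
  classical
  rcases Set.eq_empty_or_nonempty {P : Set G | IsCone P} with hemp | hne
  · rw [hemp]; exact Set.finite_empty
  obtain ⟨P, hP, hfin⟩ := exists_isCone_forall_pow_conj hne hc
  obtain ⟨n, C, h0, hn, hconv, hmono, hlt, hjump⟩ :=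
    exists_convex_series hP (finite_isConvex hP hc)
  have hφex : ∀ i, ∃ φ : G → ℝ, i < n → IsHomOn (C (i + 1)) φ ∧ (∀ x ∈ C i, φ x = 0) ∧
      ∀ x ∈ C (i + 1), x ∈ P → x ∉ C i → 0 < φ x := by
    intro i
    by_cases hi : i < n
    · obtain ⟨φ, h⟩ := exists_hom_real_of_jump hP (hconv i) (hconv (i + 1)) (hlt i hi).le
        (hjump i hi) hfin
      exact ⟨φ, fun _ => h⟩
    · exact ⟨0, fun h => absurd h hi⟩
  choose φ hφ using hφex
  have hsign : ∀ i < n, ∀ x ∈ C (i + 1), x ∉ C i → φ i x ≠ 0 ∧ (x ∈ P ↔ 0 < φ i x) := by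
    intro i hi x hx hxC
    obtain ⟨h1, -, h3⟩ := hφ i hi
    have hx1 : x ≠ 1 := fun h => hxC (h ▸ (C i).one_mem)
    rcases hP.total hx1 with h | h
    · have := h3 x hx h hxC
      exact ⟨this.ne', iff_of_true h this⟩
    · have := h3 _ ((C (i + 1)).inv_mem hx) h (by simpa using hxC)
      rw [h1.map_inv hx] at this
      exact ⟨by linarith, iff_of_false (by simpa using hP.inv_notMem h) (by linarith)⟩
  have hker : ∀ i < n, ∀ x ∈ C (i + 1), φ i x = 0 ↔ x ∈ C i := fun i hi x hx =>
    ⟨fun h => by_contra fun hxC => (hsign i hi x hx hxC).1 h, (hφ i hi).2.1 x⟩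
  have hcex : ∀ i, ∃ c, i < n → c ∈ C (i + 1) ∧ c ∉ C i := fun i => by
    by_cases hi : i < n
    · obtain ⟨c, h⟩ := SetLike.exists_of_lt (hlt i hi)
      exact ⟨c, fun _ => h⟩
    · exact ⟨1, fun h => absurd h hi⟩
  choose c hcC using hcex
  let l : ℕ → G → ℝ := fun i g => φ i (g * c i * g⁻¹) / φ i (c i)
  have hconj : ∀ i < n, (C (i + 1)).Normal → ∀ g, ∀ x ∈ C (i + 1),
      φ i (g * x * g⁻¹) = l i g * φ i x := by
    intro i hi hN g x hx
    have h1 := hφ i hi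
    have h2 := hcC i hi
    have h3 := hsign i hi _ h2.1 h2.2
    have h4 : IsHomOn (C (i + 1)) fun x => φ i (g * x * g⁻¹) := fun x hx y hy => by
      have : g * (x * y) * g⁻¹ = (g * x * g⁻¹) * (g * y * g⁻¹) := by group
      simp only [this]
      exact h1.1 _ (hN.conj_mem x hx g) _ (hN.conj_mem y hy g)
    have h5 := h1.1.proportional hP hc (hconv (i + 1)) h4 hx h2.1
    simp only [l]
    rw [div_mul_eq_mul_div, eq_div_iff h3.1, mul_comm _ (φ i x), h5, mul_comm]
  -- Downward from C n = ⊤: C i is the kernel of φ i, which conjugation only rescales.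
  have hnormal : ∀ i ≤ n, (C i).Normal := by
    intro i hi
    induction hi using Nat.decreasingInduction with
    | self => rw [hn]; infer_instance
    | of_succ i hi ih =>
      refine ⟨fun x hx g => ?_⟩
      have hx' := (hlt i hi).le hx
      rw [← hker i hi _ (ih.conj_mem x hx' g), hconj i hi ih g x hx', (hker i hi x hx').2 hx,
        mul_zero]
  have hreverse : ∀ i, i + 1 < n → ∃ g ∈ C (i + 2), l i g < 0 := by
    intro i hi
    by_contra! hnonneg
    have hi' : i < n := by omega
    have hN := hnormal (i + 1) hi.le
    have h2 := hcC i hi'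
    have h3 := hsign i hi' _ h2.1 h2.2
    have hpos : ∀ g ∈ C (i + 2), 0 < l i g := by
      refine fun g hg => lt_of_le_of_ne (hnonneg g hg) fun h => ?_
      have h4 := hconj i hi' hN g _ h2.1
      rw [← h, zero_mul, hker i hi' _ (hN.conj_mem _ h2.1 g)] at h4
      exact h2.2 (by simpa [mul_assoc] using (hnormal i hi'.le).conj_mem _ h4 g⁻¹)
    have h5 := hcC (i + 1) hi
    have hle := (hlt (i + 1) hi).le
    by_cases hone : ∀ g ∈ C (i + 2), l i g = 1
    · refine false_of_central hP hc (hconv (i + 2)) hle (hφ i hi').1 (hφ (i + 1) hi).1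
        (hker (i + 1) hi) (fun g hg x hx => ⟨hN.conj_mem x hx g, ?_⟩) h2.1 h3.1 h5.1 h5.2
      rw [hconj i hi' hN g x hx, hone g hg, one_mul]
    · push Not at hone
      obtain ⟨t, ht, ht1⟩ := hone
      refine false_of_scaling hP hc (hconv (i + 2)) hle (hφ i hi').1
        (fun g hg x hx => ⟨hN.conj_mem x hx g, hconj i hi' hN g x hx⟩) hpos ?_ h2.1 h3.1 ht ht1
      intro x hx y hy
      have h6 := (hφ (i + 1) hi).1
      have h7 := mul_mem hx hy
      have h8 := mul_mem h7 (inv_mem hx)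
      rw [← hker (i + 1) hi _ (mul_mem h8 (inv_mem hy)), h6 _ h8 _ (inv_mem hy), h6.map_conj hx hy,
        h6.map_inv hy]
      ring
  have hrank : ∀ i < n, ∀ x ∈ C (i + 1), x ∉ C i → x ∈ P → ∀ y ∈ C (i + 1), y ∉ C i → y ∈ P →
      ∃ m k : ℕ, 0 < m ∧ 0 < k ∧ ∃ d ∈ C i, x ^ m = y ^ k * d := by
    intro i hi x hx hxC hxP y hy hyC hyP
    have h1 := (hφ i hi).1
    obtain ⟨m, k, hm, hk, he⟩ := h1.exists_nat_mul_eq hP hc (hconv (i + 1)) hx hy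
      ((hsign i hi x hx hxC).2.1 hxP) ((hsign i hi y hy hyC).2.1 hyP)
    refine ⟨m, k, hm, hk, (y ^ k)⁻¹ * x ^ m, ?_, by group⟩
    have hyk := pow_mem hy k
    have hxm := pow_mem hx m
    rw [← hker i hi _ (mul_mem (inv_mem hyk) hxm), h1 _ (inv_mem hyk) _ hxm, h1.map_inv hyk,
      h1.map_pow hy, h1.map_pow hx]
    linarith
  have hagree : ∀ Q, IsCone Q → ∀ i < n, AgreeUpToSign P Q (C i) (C (i + 1)) := by
    intro Q hQ i hi
    induction i with
    -- C 0 is trivial, so positive elements of the bottom jump have common powers and share their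
    -- `Q`-sign.
    | zero =>
      refine agreeUpToSign_of_forall_mem hP hQ ?_
      by_contra! h
      obtain ⟨⟨x, hx, hxC, hxP, hxQ⟩, ⟨y, hy, hyC, hyP, hyQ⟩⟩ := h
      obtain ⟨m, k, hm, hk, d, hd, he⟩ := hrank 0 hi x hx hxC hxP y hy hyC hyP
      rw [h0, Subgroup.mem_bot] at hd
      rw [hd, mul_one] at he
      exact hxQ ((hQ.pow_mem_iff hm).1 (he ▸ hQ.pow_mem hyQ hk))
    | succ i ih =>
      have hi' : i < n := by omega
      obtain ⟨g, hgE, hg⟩ := hreverse i hi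
      have hN := hnormal (i + 1) hi.le
      have hN' := hnormal i hi'.le
      have h2 := hcC i hi'
      have h3 := (hsign i hi' _ h2.1 h2.2).1
      refine AgreeUpToSign.step hP hQ (hlt i hi') (ih hi') hgE (fun hgD => ?_)
        (fun x hx hxC => ?_) (hrank (i + 1) hi)
      · have h4 := hconj i hi' hN g _ h2.1
        rw [(hφ i hi').1.map_conj hgD h2.1] at h4
        have h5 : l i g = 1 := (mul_eq_right₀ h3).1 h4.symm
        linarith
      · have h4 : g * x * g⁻¹ ∉ C i := fun h =>
          hxC (by simpa [mul_assoc] using hN'.conj_mem _ h g⁻¹)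
        have h5 := hsign i hi' x hx hxC
        rw [(hsign i hi' _ (hN.conj_mem x hx g) h4).2, h5.2, hconj i hi' hN g x hx, not_lt]
        constructor
        · intro h
          by_contra! h'
          exact absurd h (not_lt.2 (mul_nonpos_of_nonpos_of_nonneg hg.le h'.le))
        · intro h
          exact mul_pos_of_neg_of_neg hg (lt_of_le_of_ne h h5.1)
  -- A cone is determined by the jumps on which it agrees with `P`; on the others it is opposite.
  refine Set.Finite.of_injOn (f := fun Q => {i : Fin n | ∀ x ∈ C (i + 1), x ∉ C i →
    (x ∈ Q ↔ x ∈ P)}) (Set.mapsTo_univ _ _) ?_ Set.finite_univ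
  intro Q hQ Q' hQ' hQQ
  refine IsCone.eq_of_subset hQ hQ' fun x hxQ => ?_
  have hex : ∃ j, x ∈ C j := ⟨n, hn ▸ Subgroup.mem_top x⟩
  have hx1 := IsCone.ne_one hQ hxQ
  have hj0 : Nat.find hex ≠ 0 := fun h => by
    have := Nat.find_spec hex
    rw [h, h0, Subgroup.mem_bot] at this
    exact hx1 this
  obtain ⟨i, hi⟩ := Nat.exists_eq_succ_of_ne_zero hj0
  have hxi : x ∈ C (i + 1) := by
    have := Nat.find_spec hex
    rwa [hi] at this
  have hxi' : x ∉ C i := Nat.find_min hex (by omega)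
  have hin : i < n := by
    have := Nat.find_min' hex (show x ∈ C n from hn ▸ Subgroup.mem_top x)
    omega
  have h1 := Set.ext_iff.1 hQQ ⟨i, hin⟩
  simp only [Set.mem_ofPred_eq] at h1
  rcases hagree Q hQ i hin with h2 | h2
  · exact (h1.1 h2 x hxi hxi').2 ((h2 x hxi hxi').1 hxQ)
  · rcases hagree Q' hQ' i hin with h3 | h3
    · exact absurd ((h1.2 h3 x hxi hxi').1 hxQ) ((h2 x hxi hxi').1 hxQ)
    · exact (h3 x hxi hxi').2 ((h2 x hxi hxi').1 hxQ)

theorem theorem3p1 (Γ : Type*) [Group Γ] (h : Infinite (LeftOrdering Γ)) :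
    Uncountable (LeftOrdering Γ) := by
  rw [← not_countable_iff]
  intro hcount
  have h1 : Countable {P : Set Γ | IsCone P} := (leftOrderingEquiv Γ).symm.injective.countable
  have h2 := (finite_setOf_isCone (Set.countable_coe_iff.1 h1)).to_subtype
  exact not_finite_iff_infinite.2 h (Finite.of_injective
    (β := {P : Set Γ | IsCone P}) _ (leftOrderingEquiv Γ).injective)
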